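/- **Conventions.** Boxes of Young diagrams are drawn in English notation; the box in row $i$ and column $j$ has content $c(\square)=j-i$. For a partition $\lambda=(\lambda_1,\dots,\lambda_r)$ (possibly empty, with $\lambda_1:=0$ then) put $n_\lambda=|\lambda|+\lambda_1$, let $\lambda^{(n)}=(n-|\lambda|,\lambda_1,\dots,\lambda_r)$ for $n\ge n_\lambda$, and $\lambda^{(\infty)}=\bigcup_{n\ge n_\lambda}\lambda^{(n)}$. Let $\Omega(\lambda)$ be the set of labellings $T:\lambda^{(\infty)}\to\mathbb Z_{\ge0}$ with finitely many nonzero values that are weakly decreasing along rows (left to right) and strictly decreasing along columns (top to bottom); $\mathrm{rk}(T)$ is the least $n\ge n_\lambda$ such that $T$ vanishes outside $\lambda^{(n)}$. Formal products $iq^a$ ($i\ge1$, $a\ge0$) are ordered by $jq^m<kq^\ell$ iff $m>\ell$, or $m=\ell$ and $j<k$. For a partition $\mu$ of $n$, $\mathrm{PSYT}(\mu)$ is the set of labellings $\tau:\mu\to\{jq^b:1\le j\le n,\ b\ge 0\}$, strictly increasing along rows and columns, in which each $j\in\{1,\dots,n\}$ occurs in exactly one box. It is partially ordered by the relation generated by: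 $\Psi(\tau)>\tau$, where $\Psi$ replaces each label $kq^a$ with $k\ge2$ by $(k-1)q^a$ and $1q^a$ by $nq^{a+1}$; and $s_i(\tau)>\tau$, where $s_i$ exchanges the numbers $i$ and $i+1$ and leaves the exponents in place, whenever the exponents $w(i),w(i+1)$ and contents $c(i),c(i+1)$ of the boxes of $\tau$ containing $i$ and $i+1$ satisfy $w(i)<w(i+1)$, or $w(i)=w(i+1)$ and $c(i)-c(i+1)>1$. For $T\in\Omega(\lambda)$ and $n=\mathrm{rk}(T)$, let $\mathrm{Min}(T)$ be the (unique) least element among the $\tau\in\mathrm{PSYT}(\lambda^{(n)})$ whose exponents of $q$ are given by $T|_{\lambda^{(n)}}$, and let $\mu_T$ be the composition of $n$ whose Young subgroup is generated by the $s_i$ for which $i$ and $i+1$ occur in $\mathrm{Min}(T)$ in the same row and with the same exponent of $q$. $\mathrm{APSYT}(\lambda;T)$ is the set of labellings $\tau:\lambda^{(\infty)}\to\{iq^a:i\ge1,a\ge0\}$, strictly increasing along rows and columns, in which each $i\ge1$ occurs in exactly one box and in which the exponent of $q$ in box $\square$ is $T(\square)$. If $\tau$ is such a tableau, on $\lambda^{(\infty)}$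 or on $\lambda^{(n)}$, with exponents given by $T$, then $\mathrm{Inv}(\tau)$ is the set of pairs of boxes $(\square_1,\square_2)$ such that $\square_1$ strictly precedes $\square_2$ in the order in which larger values of $T$ come first and ties are broken column by column from left to right, top to bottom within a column, and such that $\tau(\square_1)=iq^a$, $\tau(\square_2)=jq^b$ with $i>j$. Put $\mathrm{inv}(\tau)=|\mathrm{Inv}(\tau)|$ and $\mathrm I(T)=\mathrm{Inv}(\mathrm{Min}(T))$. Finally $[m]_t!=\prod_{i=1}^m\frac{1-t^i}{1-t}$ and $[\mu]_t!=\prod_k[\mu_k]_t!$. **Theorem.** Let $\lambda$ be a partition and $T\in\Omega(\lambda)$. Then $\mathrm{Min}(T)$ exists and is unique, $\mathrm{Inv}(\tau)$ is finite for every $\tau\in\mathrm{APSYT}(\lambda;T)$, and the following equality holds in $\mathbb Q(q)((t))$, the series on the right being $t$-adically convergent: $$\frac{\prod_{\square\in\lambda^{(\mathrm{rk}(T))}}\left(1-q^{-T(\square)}t^{\mathrm{rk}(T)-|\lambda|-c(\square)}\right)}{(1-t)^{\mathrm{rk}(T)}[\mu_T]_t!}\prod_{(\square_1,\square_2)\in\mathrm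 I(T)}\frac{1-q^{T(\square_2)-T(\square_1)}t^{c(\square_2)-c(\square_1)}}{1-q^{T(\square_2)-T(\square_1)}t^{c(\square_2)-c(\square_1)+1}}$$ $$=\sum_{\tau\in\mathrm{APSYT}(\lambda;T)}t^{\mathrm{inv}(\tau)}\prod_{(\square_1,\square_2)\in\mathrm{Inv}(\tau)}\frac{1-q^{T(\square_2)-T(\square_1)}t^{c(\square_2)-c(\square_1)-1}}{1-q^{T(\square_2)-T(\square_1)}t^{c(\square_2)-c(\square_1)+1}}.$$ -/

import Mathlib

namespace VVMac

/-! ### Boxes, diagrams and contents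

A partition is a `YoungDiagram`; the box `(i, j)` lies in row `i` and column `j`, both counted
from `0` (English notation). -/

/-- The content of a box: column minus row. -/
def content (b : ℕ × ℕ) : ℤ := (b.2 : ℤ) - (b.1 : ℤ)

/-- The set of boxes of a Young diagram. -/
abbrev boxes (μ : YoungDiagram) : Set (ℕ × ℕ) := (μ.cells : Set (ℕ × ℕ))

/-- `n_λ = |λ| + λ₁`. -/
def nMin (lam : YoungDiagram) : ℕ := lam.card + lam.rowLen 0

/-- `λ^{(n)} = (n - |λ|, λ₁, λ₂, …)`, for `n ≥ n_λ`. (The `max` has no effect for `n ≥ n_λ`; for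
smaller `n`, which are never used, the value is `λ^{(n_λ)}`.) -/
def pad (lam : YoungDiagram) (n : ℕ) : YoungDiagram where
  cells := ({0} ×ˢ Finset.range (max (n - lam.card) (lam.rowLen 0))) ∪
    lam.cells.image (fun b => (b.1 + 1, b.2))
  isLowerSet := by
    rintro ⟨i, j⟩ ⟨i', j'⟩ hle hmem
    obtain ⟨h1, h2⟩ := Prod.mk_le_mk.mp hle
    simp only [Finset.coe_union, Set.mem_union, Finset.mem_coe, Finset.mem_product,
      Finset.mem_singleton, Finset.mem_range, Finset.mem_image, Prod.mk.injEq,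
      YoungDiagram.mem_cells, Prod.exists] at hmem ⊢
    rcases hmem with ⟨h0, hj⟩ | ⟨a, b, hab, ha, hb⟩
    · left
      exact ⟨by omega, by omega⟩
    · subst ha hb
      rcases Nat.eq_zero_or_pos i' with h0 | h0
      · left
        have h3 : (0, b) ∈ lam := lam.up_left_mem (Nat.zero_le a) le_rfl hab
        rw [YoungDiagram.mem_iff_lt_rowLen] at h3
        refine ⟨h0, ?_⟩
        have := le_max_right (n - lam.card) (lam.rowLen 0)
        omega
      · right
        exact ⟨i' - 1, j', lam.up_left_mem (by omega) h2 hab, by omega, rfl⟩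

/-- `λ^{(∞)}`, the union of all `λ^{(n)}` with `n ≥ n_λ`. -/
def padInf (lam : YoungDiagram) : Set (ℕ × ℕ) := ⋃ n ≥ nMin lam, boxes (pad lam n)

theorem pad_subset_padInf (lam : YoungDiagram) (n : ℕ) : boxes (pad lam n) ⊆ padInf lam := by
  intro b hb
  simp only [padInf, Set.mem_iUnion]
  refine ⟨max n (nMin lam), le_max_right _ _, ?_⟩
  rw [Finset.mem_coe, pad, Finset.mem_union, Finset.mem_product, Finset.mem_singleton,
    Finset.mem_range] at hb ⊢
  rcases hb with ⟨h0, hj⟩ | hb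
  · left
    exact ⟨h0, lt_of_lt_of_le hj (max_le_max (Nat.sub_le_sub_right (le_max_left _ _) _) le_rfl)⟩
  · exact Or.inr hb

/-! ### Labels and labellings -/

/-- The formal product `i q^a`, with `idx = i` and `exp = a`. -/
@[ext]
structure PLabel where
  idx : ℕ
  exp : ℕ

/-- `j q^m < k q^l` iff `m > l`, or `m = l` and `j < k`. -/
instance : LT PLabel where
  lt x y := y.exp < x.exp ∨ (x.exp = y.exp ∧ x.idx < y.idx)

section Labellings

variable {D : Set (ℕ × ℕ)}

/-- Strictly increasing along rows and columns. -/
def StrictlyIncreasing (τ : D → PLabel) : Prop :=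
  (∀ b b' : D, b.1.1 = b'.1.1 → b.1.2 < b'.1.2 → τ b < τ b') ∧
  (∀ b b' : D, b.1.2 = b'.1.2 → b.1.1 < b'.1.1 → τ b < τ b')

/-- The labelling `𝔭(τ)` by the exponents of `q`. -/
def expo (τ : D → PLabel) : D → ℕ := fun b => (τ b).exp

/-- `b` comes before `b'` in the column-standard labelling: columns from left to right, each
column from top to bottom. -/
def ColBefore (b b' : ℕ × ℕ) : Prop := b.2 < b'.2 ∨ (b.2 = b'.2 ∧ b.1 < b'.1)

/-- The strict order on boxes that defines `S(T)`: larger values of `T` come first, ties are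
broken by the column-standard labelling. -/
def Precedes (T : D → ℕ) (b b' : D) : Prop :=
  T b' < T b ∨ (T b = T b' ∧ ColBefore b.1 b'.1)

/-- The standard labelling `S(T)`, which numbers the boxes `1, 2, 3, …` in the order
`Precedes T`. -/
noncomputable def stdLabel (T : D → ℕ) (b : D) : ℕ := {b' : D | Precedes T b' b}.ncard + 1

/-- The set `Inv(τ)` of inversion pairs of `τ`. -/
def Inv (τ : D → PLabel) : Set (D × D) :=
  {p | stdLabel (expo τ) p.1 < stdLabel (expo τ) p.2 ∧ (τ p.2).idx < (τ p.1).idx}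

/-- The labelling `s_j(τ)`: the numbers `j` and `j + 1` are exchanged, exponents stay in place. -/
def swapLabel (j : ℕ) (τ : D → PLabel) : D → PLabel := fun b =>
  if (τ b).idx = j then ⟨j + 1, (τ b).exp⟩
  else if (τ b).idx = j + 1 then ⟨j, (τ b).exp⟩
  else τ b

/-- The labelling `Ψ(τ)` (for `n` boxes): `k q^a` becomes `(k-1) q^a` if `k ≥ 2`, and `1 q^a`
becomes `n q^{a+1}`. -/
def psiLabel (n : ℕ) (τ : D → PLabel) : D → PLabel := fun b =>
  if 2 ≤ (τ b).idx then ⟨(τ b).idx - 1, (τ b).exp⟩ else ⟨n, (τ b).exp + 1⟩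

end Labellings

/-! ### Periodic standard Young tableaux and their order -/

/-- Non-negative periodic standard Young tableaux of shape `μ`. -/
structure PSYT (μ : YoungDiagram) where
  label : boxes μ → PLabel
  idx_mem : ∀ b, (label b).idx ∈ Finset.Icc 1 μ.card
  existsUnique_idx : ∀ j ∈ Finset.Icc 1 μ.card, ∃! b, (label b).idx = j
  strict : StrictlyIncreasing label

/-- The generating relations `τ < τ'` of the partial order on `PSYT(μ)`. -/
inductive Cover {μ : YoungDiagram} : PSYT μ → PSYT μ → Prop
  | psi (τ τ' : PSYT μ) (h : τ'.label = psiLabel μ.card τ.label) : Cover τ τ'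
  | swap_exp (τ τ' : PSYT μ) (i : ℕ) (b₁ b₂ : boxes μ)
      (h₁ : (τ.label b₁).idx = i) (h₂ : (τ.label b₂).idx = i + 1)
      (hw : (τ.label b₁).exp < (τ.label b₂).exp)
      (h : τ'.label = swapLabel i τ.label) : Cover τ τ'
  | swap_content (τ τ' : PSYT μ) (i : ℕ) (b₁ b₂ : boxes μ)
      (h₁ : (τ.label b₁).idx = i) (h₂ : (τ.label b₂).idx = i + 1)
      (hw : (τ.label b₁).exp = (τ.label b₂).exp)
      (hc : 1 < content b₁.1 - content b₂.1)
      (h : τ'.label = swapLabel i τ.label) : Cover τ τ'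

/-- The partial order on `PSYT(μ)`. -/
instance (μ : YoungDiagram) : LE (PSYT μ) where
  le := Relation.ReflTransGen Cover

/-- `M` is `Min(T)`: the least element of `PSYT(μ; T) = {τ ∈ PSYT(μ) : 𝔭(τ) = T}`. -/
def IsMinTableau {μ : YoungDiagram} (T : boxes μ → ℕ) (M : PSYT μ) : Prop :=
  expo M.label = T ∧ ∀ τ : PSYT μ, expo τ.label = T → M ≤ τ

/-- The numbers `i` and `i + 1` occur in the same row of `M` with the same power of `q`. -/
def Joined {μ : YoungDiagram} (M : PSYT μ) (i : ℕ) : Prop :=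
  ∃ b b' : boxes μ, (M.label b).idx = i ∧ (M.label b').idx = i + 1 ∧
    b.1.1 = b'.1.1 ∧ (M.label b).exp = (M.label b').exp

open Classical in
/-- For `M = Min(T)` this is the composition `μ(T)` of `n`: its Young subgroup is generated by the
`s_i` with `Joined M i`, that is, `{1, …, n}` is cut between `i` and `i + 1` exactly when
`Joined M i` fails. -/
noncomputable def muComp {μ : YoungDiagram} (M : PSYT μ) : Composition μ.card :=
  CompositionAsSet.toComposition
    { boundaries := Finset.univ.filter
        (fun i => i = 0 ∨ i = Fin.last μ.card ∨ ¬ Joined M (i : ℕ))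
      zero_mem := by simp
      getLast_mem := by simp }

/-! ### Labellings of the infinite diagram -/

/-- The set `Ω(λ)`. -/
structure Omega (lam : YoungDiagram) where
  val : padInf lam → ℕ
  finite_support : {b | val b ≠ 0}.Finite
  row_weak : ∀ b b' : padInf lam, b.1.1 = b'.1.1 → b.1.2 < b'.1.2 → val b' ≤ val b
  col_strict : ∀ b b' : padInf lam, b.1.2 = b'.1.2 → b.1.1 < b'.1.1 → val b' < val b

/-- The restriction of `T` to `λ^{(n)}`. -/
def Omega.restrict {lam : YoungDiagram} (T : Omega lam) (n : ℕ) : boxes (pad lam n) → ℕ :=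
  fun b => T.val ⟨b.1, pad_subset_padInf lam n b.2⟩

/-- The rank `rk(T)`: the least `n ≥ n_λ` such that `T` vanishes outside `λ^{(n)}`. -/
noncomputable def Omega.rk {lam : YoungDiagram} (T : Omega lam) : ℕ :=
  sInf {n | nMin lam ≤ n ∧ ∀ b : padInf lam, b.1 ∉ boxes (pad lam n) → T.val b = 0}

/-- Non-negative asymptotic periodic standard Young tableaux with base shape `λ`. -/
structure APSYT (lam : YoungDiagram) where
  label : padInf lam → PLabel
  idx_pos : ∀ b, 1 ≤ (label b).idx
  strict : StrictlyIncreasing label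
  finite_exp : {b | 0 < (label b).exp}.Finite
  existsUnique_idx : ∀ i, 1 ≤ i → ∃! b, (label b).idx = i

/-- The set `APSYT(λ; T)`. -/
def APSYTOver {lam : YoungDiagram} (T : Omega lam) : Type :=
  {τ : APSYT lam // expo τ.label = T.val}

/-! ### The field `ℚ(q)((t))` -/

/-- The field `ℚ(q)((t))`, with the `t`-adic topology that Mathlib puts on Laurent series. -/
abbrev Kqt : Type := LaurentSeries (RatFunc ℚ)

noncomputable def q : Kqt := HahnSeries.C RatFunc.X

noncomputable def t : Kqt := HahnSeries.single 1 1

/-- `[n]_t! = ∏_{i=1}^n (1 - t^i) / (1 - t)`. -/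
noncomputable def tFactorial (n : ℕ) : Kqt := ∏ i ∈ Finset.Icc 1 n, (1 - t ^ i) / (1 - t)

/-- `[μ]_t! = [μ₁]_t! [μ₂]_t! ⋯` for a composition `μ`. -/
noncomputable def tFactorialComp {n : ℕ} (μ : Composition n) : Kqt :=
  (μ.blocks.map tFactorial).prod

/-- `1 - q^{T(b₂) - T(b₁)} t^{c(b₂) - c(b₁) + k}`, for the pair `p = (b₁, b₂)`. -/
noncomputable def pairFactor {D : Set (ℕ × ℕ)} (T : D → ℕ) (p : D × D) (k : ℤ) : Kqt :=
  1 - q ^ ((T p.2 : ℤ) - (T p.1 : ℤ)) * t ^ (content p.2.1 - content p.1.1 + k)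

/-- The product side of the identity, with `M` in the place of `Min(T|_{λ^{(rk T)}})`. -/
noncomputable def productSide {lam : YoungDiagram} (T : Omega lam) (M : PSYT (pad lam T.rk)) :
    Kqt :=
  (∏ b : boxes (pad lam T.rk),
      (1 - q ^ (-(T.restrict T.rk b : ℤ)) * t ^ ((T.rk : ℤ) - (lam.card : ℤ) - content b.1))) /
    ((1 - t) ^ T.rk * tFactorialComp (muComp M)) *
  ∏ᶠ p ∈ Inv M.label, pairFactor (T.restrict T.rk) p 0 / pairFactor (T.restrict T.rk) p 1

/-- The summand of the series side that belongs to `τ ∈ APSYT(λ; T)`. -/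
noncomputable def seriesTerm {lam : YoungDiagram} (T : Omega lam) (τ : APSYTOver T) : Kqt :=
  t ^ (Inv τ.1.label).ncard *
    ∏ᶠ p ∈ Inv τ.1.label, pairFactor T.val p (-1) / pairFactor T.val p 1

end VVMac

/-! Number the boxes of λ^(∞) along `Precedes T` and give the i-th box the node x_i = q^T t^c. A
tableau over T becomes a permutation π of ℕ, and its summand becomes the product, over the
inversions i < j of π, of `invWeight` = (t x_i - x_j)/(x_i - t x_j). This weight vanishes when x_j =
t x_i, which for i < j happens exactly for horizontal neighbours with equal T. Hence permutations
violating the row condition contribute zero (the column condition is automatic, as T decreases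
strictly there), and the sum over tableaux may be taken over all permutations.

For permutations of N letters the sum is the Hall-Littlewood symmetrization Σ_σ ∏_{i<j} (x_σi - t
x_σj)/(x_σi - x_σj) = [N]_t!, divided by its summand at the identity (`sum_perm_prod_invWeight`).
From n = rk(T) on the nodes form a geometric progression with ratio t, so the value for N = n + k
telescopes (`value_permsBelow`), and k → ∞ gives a closed form (`hasSum_straight`). The series
converges because all but finitely many pairs have weight divisible by t, while a permutation that
increases from n on and is not supported below n + k has at least k inversions.

On the product side, Min(T) numbers the boxes by increasing T and then row by row; every other
tableau over T is sorted into it by adjacent swaps, each going down in the order. Among the pairs in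
`Precedes` order, those inverted in Min(T) give the product over I(T). The others lie in one row
with equal T, and their factors telescope to 1/[μ_T]_t! (`prod_precedes_eq`). -/

namespace VVMac

open Finset Polynomial

/-! ### The symmetrization identity for finitely many nodes -/

section Symmetrization

variable {K : Type*} [Field K]

/-- Lagrange interpolation of `∏ (X - t x_b) - ∏ (X - x_b)` at the nodes `x_a`, evaluated
at `0`. -/
theorem sum_prod_erase_div {ι : Type*} [DecidableEq ι] (s : Finset ι) (x : ι → K) (t : K)
    (ht : t ≠ 1) (hx : ∀ i ∈ s, x i ≠ 0) (hinj : Set.InjOn x s) :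
    ∑ a ∈ s, ∏ b ∈ s.erase a, (x a - t * x b) / (x a - x b) = (1 - t ^ #s) / (1 - t) := by
  rcases s.eq_empty_or_nonempty with rfl | hs
  · simp
  have h1t : (1 - t) ≠ 0 := sub_ne_zero.mpr ht.symm
  have hdeg : (Lagrange.nodal s (fun b => t * x b) - Lagrange.nodal s x).degree < #s := by
    have h := degree_sub_lt_left (p := Lagrange.nodal s (fun b => t * x b))
      (q := Lagrange.nodal s x)
      (by simp [Lagrange.degree_nodal]) Lagrange.nodal_ne_zero
      (by rw [Lagrange.nodal_monic.leadingCoeff, Lagrange.nodal_monic.leadingCoeff])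
    rwa [Lagrange.degree_nodal] at h
  have h0 := congrArg (eval 0) (Lagrange.eq_interpolate hinj hdeg)
  rw [Lagrange.interpolate_apply, eval_finsetSum, eval_sub, Lagrange.eval_nodal,
    Lagrange.eval_nodal] at h0
  have hP : ∏ b ∈ s, (0 - x b) ≠ 0 := prod_ne_zero_iff.mpr fun b hb => by simpa using hx b hb
  -- At the node x_a only the first product survives. Its factor x_a - t x_a supplies, up to the
  -- scalar -(1 - t), the factor 0 - x_a that the basis polynomial at 0 lacks.
  have hterm : ∀ a ∈ s, eval 0 (C (eval (x a) (Lagrange.nodal s (fun b => t * x b) -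
      Lagrange.nodal s x)) * Lagrange.basis s x a) =
      -((1 - t) * (∏ b ∈ s, (0 - x b)) *
        ∏ b ∈ s.erase a, (x a - t * x b) / (x a - x b)) := by
    intro a ha
    rw [eval_mul, eval_C, eval_sub, Lagrange.eval_nodal_at_node ha, sub_zero, Lagrange.eval_nodal,
      Lagrange.basis, eval_prod, ← mul_prod_erase s _ ha, ← mul_prod_erase s _ ha]
    have : ∀ b ∈ s.erase a, eval 0 (Lagrange.basisDivisor (x a) (x b)) =
        (0 - x b) / (x a - x b) := by
      intro b _
      simp [Lagrange.basisDivisor]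
      ring
    rw [prod_congr rfl this, prod_div_distrib, prod_div_distrib]
    ring
  rw [sum_congr rfl hterm, sum_neg_distrib, ← mul_sum] at h0
  have hl : ∏ b ∈ s, (0 - t * x b) = t ^ #s * ∏ b ∈ s, (0 - x b) := by
    rw [← prod_const, ← prod_mul_distrib]
    exact prod_congr rfl fun b _ => by ring
  rw [hl] at h0
  rw [eq_div_iff h1t]
  apply mul_left_cancel₀ hP
  linear_combination h0

theorem prod_ite_lt_fin_succ {n : ℕ} (f : Fin (n + 1) → Fin (n + 1) → K) :
    ∏ i, ∏ j, (if i < j then f i j else 1) =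
      (∏ j : Fin n, f 0 j.succ) * ∏ i : Fin n, ∏ j : Fin n,
        if i < j then f i.succ j.succ else 1 := by
  rw [Fin.prod_univ_succ]
  congr 1
  · rw [Fin.prod_univ_succ]; simp
  · refine prod_congr rfl fun i _ => ?_
    rw [Fin.prod_univ_succ]; simp

/-- The symmetrization of `∏_{i<j} (x_i - t x_j) / (x_i - x_j)` is the `t`-factorial. -/
theorem sum_perm_prod_div (t : K) (ht : t ≠ 1) (n : ℕ) (x : Fin n → K) (hx : ∀ i, x i ≠ 0)
    (hinj : Function.Injective x) :
    ∑ σ : Equiv.Perm (Fin n), ∏ i, ∏ j,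
      (if i < j then (x (σ i) - t * x (σ j)) / (x (σ i) - x (σ j)) else 1) =
      ∏ i ∈ range n, (1 - t ^ (i + 1)) / (1 - t) := by
  induction n with
  | zero => simp
  | succ n ih =>
    rw [← Equiv.sum_comp Equiv.Perm.decomposeFin.symm, Fintype.sum_prod_type]
    -- Fix σ 0 = a. The factors with i = 0 depend on a alone; the others form the sum for the n
    -- remaining nodes, listed as `swap 0 a k.succ`.
    have key : ∀ a : Fin (n + 1), ∑ e : Equiv.Perm (Fin n), ∏ i, ∏ j, (if i < j then
        (x (Equiv.Perm.decomposeFin.symm (a, e) i) -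
          t * x (Equiv.Perm.decomposeFin.symm (a, e) j)) /
        (x (Equiv.Perm.decomposeFin.symm (a, e) i) - x (Equiv.Perm.decomposeFin.symm (a, e) j))
        else 1) = (∏ b ∈ univ.erase a, (x a - t * x b) / (x a - x b)) *
          ∏ i ∈ range n, (1 - t ^ (i + 1)) / (1 - t) := by
      intro a
      rw [← ih (fun k => x (Equiv.swap 0 a k.succ)) (fun i => hx _)
        (hinj.comp ((Equiv.injective _).comp (Fin.succ_injective n))), mul_sum]
      refine sum_congr rfl fun e _ => ?_
      rw [prod_ite_lt_fin_succ]
      simp only [Equiv.Perm.decomposeFin_symm_apply_zero,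
        Equiv.Perm.decomposeFin_symm_apply_succ]
      congr 1
      rw [Equiv.prod_comp e (fun k => (x a - t * x (Equiv.swap 0 a k.succ)) /
        (x a - x (Equiv.swap 0 a k.succ)))]
      refine prod_bij (fun k _ => Equiv.swap 0 a k.succ) ?_ ?_ ?_ (fun _ _ => rfl)
      · intro k _
        rw [mem_erase]
        refine ⟨fun h => ?_, mem_univ _⟩
        rw [Equiv.swap_apply_eq_iff, Equiv.swap_apply_right] at h
        exact Fin.succ_ne_zero _ h
      · intro k _ l _ h
        exact Fin.succ_injective n ((Equiv.injective _) h)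
      · intro b hb
        have hne : Equiv.swap 0 a b ≠ 0 := by
          rw [Ne, Equiv.swap_apply_eq_iff, Equiv.swap_apply_left]
          exact (mem_erase.mp hb).1
        obtain ⟨k, hk⟩ := Fin.exists_succ_eq_of_ne_zero hne
        exact ⟨k, mem_univ _, by rw [hk, Equiv.swap_apply_self]⟩
    simp only [key]
    rw [← sum_mul, sum_prod_erase_div univ x t ht (fun i _ => hx i) hinj.injOn, prod_range_succ,
      card_univ, Fintype.card_fin, mul_comm]

/-- The weight of an inversion between nodes `a` and `b`. -/
def invWeight (t a b : K) : K := t * ((1 - b / a * t⁻¹) / (1 - b / a * t))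

/-- The factor that a pair of nodes `a`, `b` contributes to the value of the sum over all
permutations. -/
def pairRatio (t a b : K) : K := (1 - b / a) / (1 - b / a * t)

/-- Take σ = π⁻¹ in the symmetrization and multiply by all `pairRatio` factors. A pair i < j that π
keeps in order cancels to 1; an inverted one leaves (t x_i - x_j)/(x_i - t x_j), the inversion
weight. The hypothesis `hd` keeps these denominators nonzero. -/
theorem sum_perm_prod_invWeight (t : K) (ht0 : t ≠ 0) (ht : t ≠ 1) (n : ℕ) (x : Fin n → K)
    (hx : ∀ i, x i ≠ 0) (hinj : Function.Injective x) (hd : ∀ i j, i < j → x i ≠ t * x j) :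
    ∑ π : Equiv.Perm (Fin n), ∏ i, ∏ j,
      (if i < j ∧ π j < π i then invWeight t (x i) (x j) else 1) =
      (∏ i ∈ range n, (1 - t ^ (i + 1)) / (1 - t)) *
        ∏ i, ∏ j, if i < j then pairRatio t (x i) (x j) else 1 := by
  rw [← sum_perm_prod_div t ht n x hx hinj, sum_mul,
    ← Equiv.sum_comp (Equiv.inv (Equiv.Perm (Fin n)))]
  refine sum_congr rfl fun σ _ => ?_
  have hreindex : ∏ i, ∏ j, (if i < j then (x (σ i) - t * x (σ j)) / (x (σ i) - x (σ j)) else 1)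
      = ∏ i, ∏ j, (if σ⁻¹ i < σ⁻¹ j then (x i - t * x j) / (x i - x j) else 1) := by
    rw [← Equiv.prod_comp σ (fun i => ∏ j, if σ⁻¹ i < σ⁻¹ j then
      (x i - t * x j) / (x i - x j) else 1)]
    refine prod_congr rfl fun i _ => ?_
    rw [← Equiv.prod_comp σ (fun j => if σ⁻¹ (σ i) < σ⁻¹ j then
      (x (σ i) - t * x j) / (x (σ i) - x j) else 1)]
    simp
  have hsplit : ∏ i, ∏ j, (if σ⁻¹ i < σ⁻¹ j then (x i - t * x j) / (x i - x j) else 1) =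
      ∏ i, ∏ j, (if i < j then (if σ⁻¹ i < σ⁻¹ j then (x i - t * x j) / (x i - x j) else
        (x j - t * x i) / (x j - x i)) else 1) := by
    have h1 : ∏ i, ∏ j, (if σ⁻¹ i < σ⁻¹ j then (x i - t * x j) / (x i - x j) else 1) =
        (∏ i, ∏ j, (if i < j ∧ σ⁻¹ i < σ⁻¹ j then (x i - t * x j) / (x i - x j) else 1)) *
        ∏ i, ∏ j, (if j < i ∧ σ⁻¹ i < σ⁻¹ j then (x i - t * x j) / (x i - x j) else 1) := by
      rw [← prod_mul_distrib]
      refine prod_congr rfl fun i _ => ?_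
      rw [← prod_mul_distrib]
      refine prod_congr rfl fun j _ => ?_
      rcases lt_trichotomy i j with h | h | h
      · simp [h, h.not_gt]
      · simp [h]
      · simp [h, h.not_gt]
    have h2 : ∏ i, ∏ j, (if j < i ∧ σ⁻¹ i < σ⁻¹ j then (x i - t * x j) / (x i - x j) else 1) =
        ∏ i, ∏ j, (if i < j ∧ σ⁻¹ j < σ⁻¹ i then (x j - t * x i) / (x j - x i) else 1) :=
      prod_comm
    rw [h1, h2, ← prod_mul_distrib]
    refine prod_congr rfl fun i _ => ?_
    rw [← prod_mul_distrib]
    refine prod_congr rfl fun j _ => ?_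
    by_cases h : i < j
    · have hne : σ⁻¹ i ≠ σ⁻¹ j := fun he => h.ne ((Equiv.injective _) he)
      rcases lt_or_gt_of_ne hne with h' | h'
      · simp only [h, h', h'.not_gt, and_true, and_false, if_true, if_false, mul_one]
      · simp only [h, h', h'.not_gt, and_true, and_false, if_true, if_false, one_mul]
    · simp [h]
  rw [hreindex, hsplit, ← prod_mul_distrib]
  refine prod_congr rfl fun i _ => ?_
  rw [← prod_mul_distrib]
  refine prod_congr rfl fun j _ => ?_
  by_cases h : i < j
  · have hi := hx i
    have hne1 : x i - x j ≠ 0 := sub_ne_zero.mpr fun he => h.ne (hinj he)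
    have hne2 : x j - x i ≠ 0 := sub_ne_zero.mpr fun he => h.ne' (hinj he)
    have hne3 : x i - t * x j ≠ 0 := sub_ne_zero.mpr (hd i j h)
    have hden : 1 - x j / x i * t = (x i - t * x j) / x i := by field_simp
    have hp : pairRatio t (x i) (x j) = (x i - x j) / (x i - t * x j) := by
      rw [pairRatio, hden]
      field_simp
    have hw : invWeight t (x i) (x j) = (t * x i - x j) / (x i - t * x j) := by
      rw [invWeight, hden]
      field_simp
    have hne : σ⁻¹ i ≠ σ⁻¹ j := fun he => h.ne ((Equiv.injective _) he)
    rcases lt_or_gt_of_ne hne with h' | h'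
    · simp only [Equiv.inv_apply, h, h', h'.not_gt, if_true, hp, and_false, if_false]
      field_simp
    · simp only [Equiv.inv_apply, h, h', h'.not_gt, if_true, hp, hw, and_true, if_false]
      rw [div_mul_div_comm, div_eq_div_iff hne3 (mul_ne_zero hne2 hne3)]
      ring
  · simp [h]

end Symmetrization

end VVMac

namespace VVMac

open Finset Filter Topology

/-! ### Inversions of permutations of ℕ that increase from n on -/

section Permutations

/-- The set of inversions of a permutation of `ℕ`. -/
def invSet (π : Equiv.Perm ℕ) : Set (ℕ × ℕ) := {p | p.1 < p.2 ∧ π p.2 < π p.1}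

/-- The permutations of `ℕ` that fix every number from `N` on. -/
def permsBelow (N : ℕ) : Finset (Equiv.Perm ℕ) :=
  univ.map ⟨fun σ : Equiv.Perm (Fin N) => σ.extendDomain (Fin.equivSubtype (n := N)),
    Equiv.Perm.extendDomainHom_injective Fin.equivSubtype⟩

theorem extendDomain_fin_apply {N : ℕ} (σ : Equiv.Perm (Fin N)) (i : Fin N) :
    σ.extendDomain (Fin.equivSubtype (n := N)) (i : ℕ) = σ i :=
  Equiv.Perm.extendDomain_apply_image σ Fin.equivSubtype i

theorem mem_permsBelow {N : ℕ} {π : Equiv.Perm ℕ} :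
    π ∈ permsBelow N ↔ ∀ i, N ≤ i → π i = i := by
  rw [permsBelow, Finset.mem_map]
  constructor
  · rintro ⟨σ, -, rfl⟩ i hi
    exact Equiv.Perm.extendDomain_apply_not_subtype _ _ hi.not_gt
  · intro h
    have hlt : ∀ i, π i < N ↔ i < N := by
      intro i
      constructor
      · intro hi
        by_contra hc
        rw [h i (not_lt.mp hc)] at hi
        exact hc hi
      · intro hi
        by_contra hc
        have := π.injective (h (π i) (not_lt.mp hc))
        omega
    refine ⟨Fin.equivSubtype.permCongr.symm (π.subtypePerm hlt), mem_univ _, ?_⟩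
    ext i
    by_cases hi : i < N
    · have := extendDomain_fin_apply (Fin.equivSubtype.permCongr.symm (π.subtypePerm hlt)) ⟨i, hi⟩
      exact this.trans (by simp)
    · rw [h i (not_lt.mp hi)]
      exact Equiv.Perm.extendDomain_apply_not_subtype _ _ hi

theorem invSet_subset_of_mem_permsBelow {N : ℕ} {π : Equiv.Perm ℕ} (h : π ∈ permsBelow N) :
    invSet π ⊆ (range N ×ˢ range N : Finset (ℕ × ℕ)) := by
  rintro ⟨i, j⟩ ⟨h1, h2⟩
  rw [mem_permsBelow] at h
  simp only [coe_product, coe_range, Set.mem_prod, Set.mem_Iio]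
  simp only at h1 h2
  have hi : i < N := by
    by_contra hc
    rw [h i (by omega), h j (by omega)] at h2
    omega
  refine ⟨hi, ?_⟩
  by_contra hc
  have h3 := h j (by omega)
  have h4 : N ≤ π i := by omega
  have := π.injective (h (π i) h4)
  omega

variable {π : Equiv.Perm ℕ} {n : ℕ}

theorem lt_of_mem_invSet (hπ : ∀ i j, n ≤ i → i < j → π i < π j) {p : ℕ × ℕ}
    (hp : p ∈ invSet π) : p.1 < n := by
  by_contra hc
  exact (hπ p.1 p.2 (not_lt.mp hc) hp.1).not_gt hp.2

theorem finite_invSet (hπ : ∀ i j, n ≤ i → i < j → π i < π j) : (invSet π).Finite := by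
  refine (finite_toSet (range n ×ˢ (range ((range n).sup π)).image π.symm)).subset ?_
  intro p hp
  have h1 := lt_of_mem_invSet hπ hp
  rw [coe_product, Set.mem_prod, mem_coe, mem_coe, mem_range, mem_image]
  exact ⟨h1, π p.2, mem_range.mpr (hp.2.trans_le (le_sup (f := π) (mem_range.mpr h1))), by simp⟩

/-- Each of the π h values below π h sits at some position. At most n of these positions are below
n; each of the others lies to the right of h and forms an inversion with it. -/
theorem le_ncard_invSet_of_le_apply (hπ : ∀ i j, n ≤ i → i < j → π i < π j) {h : ℕ}
    (hn : h < n) : π h ≤ n + (invSet π).ncard := by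
  have hsub : (((range (π h)).image π.symm \ range n).image fun j => (h, j) : Finset (ℕ × ℕ)) ⊆
      (finite_invSet hπ).toFinset := by
    intro p hp
    obtain ⟨j, hj, rfl⟩ := mem_image.mp hp
    obtain ⟨hj1, hj2⟩ := mem_sdiff.mp hj
    obtain ⟨l, hl, rfl⟩ := mem_image.mp hj1
    rw [Set.Finite.mem_toFinset]
    refine ⟨?_, by simpa using hl⟩
    simp only [mem_range] at hj2
    simp only
    omega
  have hcard := card_le_card hsub
  rw [card_image_of_injective _ (Prod.mk_right_injective h),
    ← Set.ncard_eq_toFinset_card _ (finite_invSet hπ)] at hcard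
  have h1 := le_card_sdiff (range n) ((range (π h)).image π.symm)
  rw [card_image_of_injective _ π.symm.injective, card_range, card_range] at h1
  omega

/-- Few inversions keep the images of the first n positions below N. For i ≥ N, monotonicity of the
tail puts all values below π i at positions before i, so π i ≤ i; the first i + 1 values all lie
below max N (π i + 1), so i ≤ π i. -/
theorem mem_permsBelow_of_ncard_lt (hπ : ∀ i j, n ≤ i → i < j → π i < π j) {N : ℕ} (hN : n ≤ N)
    (hc : n + (invSet π).ncard < N) : π ∈ permsBelow N := by
  have hhead : ∀ h < n, π h < N := fun h hn => (le_ncard_invSet_of_le_apply hπ hn).trans_lt hc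
  rw [mem_permsBelow]
  intro i hi
  apply le_antisymm
  · have : (range (π i)).image π.symm ⊆ range i := by
      intro j hj
      obtain ⟨l, hl, rfl⟩ := mem_image.mp hj
      rw [mem_range] at hl ⊢
      by_contra hc
      rcases (not_lt.mp hc).eq_or_lt with h | h
      · rw [h] at hl; simp at hl
      · have := hπ i _ (hN.trans hi) h
        simp at this
        omega
    have := card_le_card this
    rwa [card_image_of_injective _ π.symm.injective, card_range, card_range] at this
  · have : (range (i + 1)).image π ⊆ range (max N (π i + 1)) := by
      intro l hl
      obtain ⟨j, hj, rfl⟩ := mem_image.mp hl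
      rw [mem_range] at hj ⊢
      rcases lt_or_ge j n with h | h
      · exact lt_max_of_lt_left (hhead j h)
      · rcases (Nat.lt_succ_iff.mp hj).eq_or_lt with h' | h'
        · subst h'; exact lt_max_of_lt_right (by omega)
        · exact lt_max_of_lt_right (by have := hπ j i h h'; omega)
    have := card_le_card this
    rw [card_image_of_injective _ π.injective, card_range, card_range] at this
    omega

end Permutations

/-! ### Sums over permutations of finitely many nodes, and their telescoping -/

section FiniteSum

variable {K : Type*} [Field K]

/-- `π` lists `x_i` before `x_j` whenever `i < j` and `x_j = t x_i`. -/
def Straight (t : K) (x : ℕ → K) (π : Equiv.Perm ℕ) : Prop :=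
  ∀ i j, i < j → x j = t * x i → π i < π j

theorem Straight.lt_of_tail {t : K} {x : ℕ → K} {π : Equiv.Perm ℕ} (hπ : Straight t x π) {n : ℕ}
    (htail : ∀ k, x (n + k) = t ^ k * x n) (i j : ℕ) (hi : n ≤ i) (hij : i < j) : π i < π j := by
  have hstep : ∀ k, π (n + k) < π (n + (k + 1)) := fun k =>
    hπ _ _ (by omega) (by rw [htail, htail, pow_succ]; ring)
  have := strictMono_nat_of_lt_succ hstep (show i - n < j - n by omega)
  rwa [Nat.add_sub_cancel' hi, Nat.add_sub_cancel' (hi.trans hij.le)] at this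

theorem invWeight_eq_zero {t a b : K} (ht : t ≠ 0) (ha : a ≠ 0) (h : b = t * a) :
    invWeight t a b = 0 := by
  have : b / a * t⁻¹ = 1 := by rw [h]; field_simp
  rw [invWeight, this]
  simp

/-- A violation of straightness is itself an inversion, and its weight is zero. -/
theorem finprod_invSet_eq_zero {t : K} {x : ℕ → K} (ht : t ≠ 0) (hx : ∀ i, x i ≠ 0)
    {π : Equiv.Perm ℕ} (hfin : (invSet π).Finite) (h : ¬ Straight t x π) :
    ∏ᶠ p ∈ invSet π, invWeight t (x p.1) (x p.2) = 0 := by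
  unfold Straight at h
  push Not at h
  obtain ⟨i, j, hij, hx', hle⟩ := h
  rw [finprod_mem_eq_finite_toFinset_prod _ hfin]
  refine prod_eq_zero (i := (i, j)) ?_ (invWeight_eq_zero ht (hx i) hx')
  rw [Set.Finite.mem_toFinset]
  exact ⟨hij, lt_of_le_of_ne hle fun h => hij.ne' (π.injective h)⟩

theorem finprod_invSet_extendDomain {N : ℕ} (f : ℕ → ℕ → K) (σ : Equiv.Perm (Fin N)) :
    ∏ᶠ p ∈ invSet (σ.extendDomain (Fin.equivSubtype (n := N))), f p.1 p.2 =
      ∏ i : Fin N, ∏ j : Fin N, if i < j ∧ σ j < σ i then f i j else 1 := by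
  set π := σ.extendDomain (Fin.equivSubtype (n := N)) with hπ
  have hmem : π ∈ permsBelow N := Finset.mem_map.mpr ⟨σ, mem_univ _, rfl⟩
  have hset : invSet π = ((range N ×ˢ range N).filter fun p => p.1 < p.2 ∧ π p.2 < π p.1 :
      Finset (ℕ × ℕ)) := by
    ext p
    rw [coe_filter]
    exact ⟨fun h => ⟨invSet_subset_of_mem_permsBelow hmem h, h⟩, fun h => h.2⟩
  rw [hset, finprod_mem_coe_finset, prod_filter, prod_product, prod_range]
  refine prod_congr rfl fun i _ => ?_
  rw [prod_range]
  refine prod_congr rfl fun j _ => ?_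
  simp only [hπ, extendDomain_fin_apply, Fin.val_fin_lt]

theorem prod_pairs_fin_eq_range {N : ℕ} (f : ℕ → ℕ → K) :
    ∏ i : Fin N, ∏ j : Fin N, (if i < j then f i j else 1) =
      ∏ j ∈ range N, ∏ i ∈ range j, f i j := by
  rw [Finset.prod_comm, prod_range]
  refine prod_congr rfl fun j _ => ?_
  have hfilter : range (j : ℕ) = (range N).filter (· < (j : ℕ)) := by
    ext i
    simp only [mem_range, mem_filter]
    omega
  rw [hfilter, prod_filter, prod_range]
  rfl

theorem sum_permsBelow (t : K) (x : ℕ → K) (ht0 : t ≠ 0) (ht1 : t ≠ 1) (hx : ∀ i, x i ≠ 0)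
    (hinj : Function.Injective x) (hd : ∀ i j, i < j → x i ≠ t * x j) (N : ℕ) :
    ∑ π ∈ permsBelow N, ∏ᶠ p ∈ invSet π, invWeight t (x p.1) (x p.2) =
      (∏ i ∈ range N, (1 - t ^ (i + 1)) / (1 - t)) *
        ∏ j ∈ range N, ∏ i ∈ range j, pairRatio t (x i) (x j) := by
  rw [permsBelow, sum_map, ← prod_pairs_fin_eq_range (fun i j => pairRatio t (x i) (x j)),
    ← sum_perm_prod_invWeight t ht0 ht1 N (fun i => x i) (fun i => hx i)
      (hinj.comp Fin.val_injective) (fun i j h => hd i j h)]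
  exact sum_congr rfl fun σ _ =>
    finprod_invSet_extendDomain (fun i j => invWeight t (x i) (x j)) σ

theorem prod_range_one_sub_pow_div (t : K) (ht : ∀ k : ℕ, t ^ (k + 1) ≠ 1) (k : ℕ) :
    ∏ i ∈ range k, (1 - t ^ (k - i)) / (1 - t ^ (k - i + 1)) = (1 - t) / (1 - t ^ (k + 1)) := by
  have hne : ∀ k : ℕ, 1 - t ^ (k + 1) ≠ 0 := fun k => sub_ne_zero.mpr (ht k).symm
  induction k with
  | zero => simpa using (div_self (by simpa using hne 0)).symm
  | succ k ih =>
    rw [prod_range_succ']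
    simp only [Nat.add_sub_add_right, Nat.sub_zero]
    rw [ih, div_mul_div_cancel₀ (hne k)]

theorem prod_range_telescope (t y : K) (hy : ∀ k : ℕ, 1 - t ^ k * y ≠ 0) (k : ℕ) :
    ∏ i ∈ range k, (1 - t ^ i * y) / (1 - t ^ (i + 1) * y) = (1 - y) / (1 - t ^ k * y) := by
  induction k with
  | zero => simpa using (div_self (by simpa using hy 0)).symm
  | succ k ih => rw [prod_range_succ, ih, div_mul_div_cancel₀ (hy k)]

/-- The value of the sum over `permsBelow (n + k)` when the nodes from `x_n` on form a geometric
progression with ratio `t`. -/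
theorem value_permsBelow (t : K) (x : ℕ → K) (n : ℕ) (hx : ∀ i, x i ≠ 0)
    (hinj : Function.Injective x) (htail : ∀ k, x (n + k) = t ^ k * x n) (k : ℕ) :
    (∏ i ∈ range (n + k), (1 - t ^ (i + 1)) / (1 - t)) *
        ∏ j ∈ range (n + k), ∏ i ∈ range j, pairRatio t (x i) (x j) =
      (∏ i ∈ range n, (1 - t ^ (k + i + 1)) / (1 - t)) *
        (∏ i ∈ range n, (1 - x n / x i) / (1 - t ^ k * (x n / x i))) *
        ∏ j ∈ range n, ∏ i ∈ range j, pairRatio t (x i) (x j) := by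
  have hpow : ∀ k : ℕ, t ^ (k + 1) ≠ 1 := by
    intro k hk
    have := htail (k + 1)
    rw [hk, one_mul] at this
    have := hinj this
    omega
  have hne : ∀ k : ℕ, 1 - t ^ (k + 1) ≠ 0 := fun k => sub_ne_zero.mpr (hpow k).symm
  have h1t : 1 - t ≠ 0 := by simpa using hne 0
  have ht0 : t ≠ 0 := by
    rintro rfl
    have := htail 1
    simp only [pow_one, zero_mul] at this
    exact hx _ this
  -- The column of x_{n+l} splits into the head i < n, which telescopes later in l, and the l
  -- earlier tail nodes, which telescope at once.
  have hcol : ∀ l, ∏ i ∈ range (n + l), pairRatio t (x i) (x (n + l)) =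
      (∏ i ∈ range n, (1 - t ^ l * (x n / x i)) / (1 - t ^ (l + 1) * (x n / x i))) *
        ((1 - t) / (1 - t ^ (l + 1))) := by
    intro l
    rw [prod_range_add, ← prod_range_one_sub_pow_div t hpow]
    congr 1
    · refine prod_congr rfl fun i _ => ?_
      rw [pairRatio, htail l]
      congr 1 <;> ring
    · refine prod_congr rfl fun i hi => ?_
      have hi := mem_range.mp hi
      have : x (n + l) / x (n + i) = t ^ (l - i) := by
        rw [htail l, htail i, mul_div_mul_right _ _ (hx n), div_eq_iff (pow_ne_zero _ ht0),
          ← pow_add]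
        congr 1
        omega
      rw [pairRatio, this, pow_succ]
  rw [prod_range_add (fun j => ∏ i ∈ range j, pairRatio t (x i) (x j)) n k,
    prod_congr rfl fun l (_ : l ∈ range k) => hcol l, prod_mul_distrib,
    Finset.prod_comm (s := range k) (t := range n),
    prod_congr rfl fun i (hi : i ∈ range n) => prod_range_telescope t (x n / x i) ?_ k,
    add_comm n k, prod_range_add _ k n]
  -- The tail columns cancel the first k factors of [n+k]_t!, leaving only n factors.
  · have : (∏ i ∈ range k, (1 - t ^ (i + 1)) / (1 - t)) *
        ∏ i ∈ range k, (1 - t) / (1 - t ^ (i + 1)) = 1 := by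
      rw [← prod_mul_distrib]
      refine prod_eq_one fun i _ => ?_
      rw [div_mul_div_cancel₀ h1t, div_self (hne i)]
    linear_combination ((∏ i ∈ range n, (1 - t ^ (k + i + 1)) / (1 - t)) *
        (∏ i ∈ range n, (1 - x n / x i) / (1 - t ^ k * (x n / x i))) *
        ∏ j ∈ range n, ∏ i ∈ range j, pairRatio t (x i) (x j)) * this
  · intro l
    rw [sub_ne_zero, ← mul_div_assoc, ← htail l, Ne, eq_comm, div_eq_one_iff_eq (hx i)]
    intro h
    have := hinj h
    have := mem_range.mp hi
    omega

end FiniteSum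

/-! ### Passage to the limit in a valued field -/

section Convergence

variable {K Γ₀ : Type*} [Field K] [LinearOrderedCommGroupWithZero Γ₀] [Valued K Γ₀]

open Valued in
/-- A family in a valued field is summable as soon as its sums over suitable finite sets converge
and the terms outside these sets are uniformly small. -/
theorem hasSum_of_tendsto_of_small {ι : Type*} [DecidableEq ι] (F : ι → K) (s : ℕ → Finset ι)
    (L : K) (hL : Tendsto (fun N => ∑ i ∈ s N, F i) atTop (𝓝 L))
    (hsmall : ∀ γ : (MonoidWithZeroHom.ValueGroup₀ (.ofClass (v : Valuation K Γ₀)))ˣ,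
      ∀ᶠ N in atTop, ∀ i ∉ s N, v.restrict (F i) < γ.1) : HasSum F L := by
  rw [HasSum, SummationFilter.unconditional_filter]
  intro U hU
  obtain ⟨γ, hγ⟩ := Valued.mem_nhds.mp hU
  have h1 : ∀ᶠ N in atTop, v.restrict (∑ i ∈ s N, F i - L) < γ.1 :=
    hL (Valued.mem_nhds.mpr ⟨γ, subset_rfl⟩)
  obtain ⟨N, hN1, hN2⟩ := (h1.and (hsmall γ)).exists
  refine Filter.mem_map.mpr (mem_of_superset (mem_atTop (s N)) fun S hS => hγ ?_)
  have hS : s N ⊆ S := hS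
  have hsum : ∑ i ∈ S, F i - L = ∑ i ∈ S \ s N, F i + (∑ i ∈ s N, F i - L) := by
    rw [← sum_sdiff hS]; ring
  simp only [Set.mem_ofPred_eq, hsum]
  exact Valuation.map_add_lt _
    (Valuation.map_sum_lt _ γ.ne_zero fun i hi => hN2 i (mem_sdiff.mp hi).2) hN1

open Valued in
-- The constant C collects the excess over v(t) of the finitely many bad pairs. It serves all sets
-- of pairs at once because each of its factors is at least 1.
theorem exists_restrict_prod_le (t : K) (ht0 : t ≠ 0) (w : ℕ × ℕ → K)
    (hbad : {p : ℕ × ℕ | p.1 < p.2 ∧ ¬ v (w p) ≤ v t}.Finite) :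
    ∃ C : MonoidWithZeroHom.ValueGroup₀ (.ofClass (v : Valuation K Γ₀)), 1 ≤ C ∧
      ∀ I : Finset (ℕ × ℕ), (∀ p ∈ I, p.1 < p.2) →
        v.restrict (∏ p ∈ I, w p) ≤ C * v.restrict t ^ #I := by
  have hvt : v.restrict t ≠ 0 := by simpa using ht0
  classical
  refine ⟨∏ p ∈ hbad.toFinset, max 1 (v.restrict (w p) / v.restrict t),
    one_le_prod' fun p _ => le_max_left _ _, fun I hI => ?_⟩
  have h1 : v.restrict (∏ p ∈ I, w p) ≤
      ∏ p ∈ I, ((if p ∈ hbad.toFinset then max 1 (v.restrict (w p) / v.restrict t) else 1) *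
        v.restrict t) := by
    rw [map_prod]
    refine prod_le_prod' fun p hp => ?_
    split_ifs with h
    · calc v.restrict (w p) = v.restrict (w p) / v.restrict t * v.restrict t := by
            rw [div_mul_cancel₀ _ hvt]
        _ ≤ _ := mul_le_mul_left (le_max_right _ _) _
    · rw [Set.Finite.mem_toFinset] at h
      rw [one_mul, Valuation.restrict_le_iff]
      by_contra hc
      exact h ⟨hI p hp, hc⟩
  refine h1.trans ?_
  rw [prod_mul_distrib, prod_const, ← prod_filter]
  refine mul_le_mul_left ?_ _
  refine prod_le_prod_of_subset_of_one_le' (fun p hp => (mem_filter.mp hp).2)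
    fun p _ _ => le_max_left _ _

open Valued in
/-- The sum of the inversion weights over all straight permutations of `ℕ`. -/
theorem hasSum_straight (t : K) (x : ℕ → K) (n : ℕ) (hx : ∀ i, x i ≠ 0)
    (hinj : Function.Injective x) (hd : ∀ i j, i < j → x i ≠ t * x j)
    (htail : ∀ k, x (n + k) = t ^ k * x n) (ht : Tendsto (fun k : ℕ => t ^ k) atTop (𝓝 0))
    (hvt : (v t : Γ₀) ≤ 1)
    (hbad : {p : ℕ × ℕ | p.1 < p.2 ∧ ¬ (v (invWeight t (x p.1) (x p.2)) : Γ₀) ≤ v t}.Finite) :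
    HasSum (fun π : {π // Straight t x π} => ∏ᶠ p ∈ invSet π.1, invWeight t (x p.1) (x p.2))
      ((∏ i ∈ range n, (1 - x n / x i)) / (1 - t) ^ n *
        ∏ j ∈ range n, ∏ i ∈ range j, pairRatio t (x i) (x j)) := by
  classical
  have ht0 : t ≠ 0 := by
    rintro rfl
    have := htail 1
    simp only [pow_one, zero_mul] at this
    exact hx _ this
  have ht1 : t ≠ 1 := by
    rintro rfl
    have := htail 1
    simp only [one_pow, one_mul] at this
    have := hinj this
    omega
  set f : Equiv.Perm ℕ → K := fun π => ∏ᶠ p ∈ invSet π, invWeight t (x p.1) (x p.2) with hf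
  change HasSum (f ∘ ((↑) : {π | Straight t x π} → Equiv.Perm ℕ)) _
  rw [hasSum_subtype_iff_indicator]
  refine hasSum_of_tendsto_of_small _ (fun k => permsBelow (n + k)) _ ?_ ?_
  -- Extending by zero off the straight permutations changes nothing: the others already have
  -- product zero.
  · have hsum : ∀ k, ∑ π ∈ permsBelow (n + k), Set.indicator {π | Straight t x π} f π =
        (∏ i ∈ range n, (1 - t ^ k * t ^ (i + 1)) / (1 - t)) *
        (∏ i ∈ range n, (1 - x n / x i) / (1 - t ^ k * (x n / x i))) *
        ∏ j ∈ range n, ∏ i ∈ range j, pairRatio t (x i) (x j) := by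
      intro k
      simp only [← pow_add, ← add_assoc]
      rw [← value_permsBelow t x n hx hinj htail, ← sum_permsBelow t x ht0 ht1 hx hinj hd]
      refine sum_congr rfl fun π hπ => ?_
      by_cases h : Straight t x π
      · rw [Set.indicator_of_mem (by exact h)]
      · rw [Set.indicator_of_notMem (by exact h)]
        exact (finprod_invSet_eq_zero ht0 hx
          ((finite_toSet _).subset (invSet_subset_of_mem_permsBelow hπ)) h).symm
    simp only [hsum]
    refine Tendsto.mul_const _ ?_
    have h0 : ∀ c : K, Tendsto (fun k => 1 - t ^ k * c) atTop (𝓝 1) := by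
      intro c
      simpa using (ht.mul_const c).const_sub 1
    have h1 : Tendsto (fun k : ℕ => (∏ i ∈ range n, (1 - t ^ k * t ^ (i + 1)) / (1 - t)) *
        ∏ i ∈ range n, (1 - x n / x i) / (1 - t ^ k * (x n / x i))) atTop
        (𝓝 ((∏ i ∈ range n, 1 / (1 - t)) * ∏ i ∈ range n, (1 - x n / x i) / 1)) := by
      refine Tendsto.mul ?_ ?_
      · exact tendsto_finsetProd _ fun i _ => (h0 _).div_const _
      · exact tendsto_finsetProd _ fun i _ => (tendsto_const_nhds).div (h0 _) one_ne_zero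
    convert h1 using 2
    simp [prod_const]
    ring
  · intro γ
    obtain ⟨C, hC1, hC⟩ := exists_restrict_prod_le t ht0
      (fun p : ℕ × ℕ => invWeight t (x p.1) (x p.2)) hbad
    have hC0 : C ≠ 0 := (zero_lt_one.trans_le hC1).ne'
    have hpos : C⁻¹ * γ.1 ≠ 0 := mul_ne_zero (inv_ne_zero hC0) γ.ne_zero
    have hev : ∀ᶠ k in atTop, v.restrict (t ^ k) < C⁻¹ * γ.1 :=
      ht (Valued.mem_nhds_zero.mpr ⟨Units.mk0 _ hpos, subset_rfl⟩)
    filter_upwards [(tendsto_sub_atTop_nat 1).eventually hev, eventually_ge_atTop 1]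
      with k hk hk1 π hπ
    by_cases h : Straight t x π
    · have htl := h.lt_of_tail htail
      -- Outside `permsBelow (n + k)` there are at least k inversions; the weaker bound k - 1 is
      -- enough.
      have hcard : k - 1 ≤ (invSet π).ncard := by
        by_contra hc
        exact hπ (mem_permsBelow_of_ncard_lt htl (by omega) (by omega))
      rw [Set.indicator_of_mem (by exact h), hf]
      simp only
      rw [finprod_mem_eq_finite_toFinset_prod _ (finite_invSet htl)]
      refine (hC _ fun p hp => ((Set.Finite.mem_toFinset _).mp hp).1).trans_lt ?_
      rw [← Set.ncard_eq_toFinset_card _ (finite_invSet htl)]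
      rw [map_pow] at hk
      have hle : v.restrict t ^ (invSet π).ncard ≤ v.restrict t ^ (k - 1) :=
        pow_le_pow_right_of_le_one' (Valuation.restrict_le_one_iff _ |>.mpr hvt) hcard
      calc _ ≤ C * v.restrict t ^ (k - 1) := mul_le_mul_right hle _
        _ < C * (C⁻¹ * γ.1) := mul_lt_mul_of_pos_left hk (zero_lt_iff.mpr hC0)
        _ = γ.1 := by rw [mul_inv_cancel_left₀ hC0]
    · rw [Set.indicator_of_notMem (by exact h), map_zero]
      exact zero_lt_iff.mpr γ.ne_zero

end Convergence

end VVMac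

namespace VVMac

open Finset Filter Topology

/-! ### Blocks of a composition and the t-factorial -/

section Compositions

variable {n : ℕ} (c : Composition n)

theorem index_eq_iff_sizeUpTo_le {i j : Fin n} (hij : i ≤ j) :
    c.index i = c.index j ↔ c.sizeUpTo (c.index j) ≤ i := by
  rw [eq_comm, ← c.mem_range_embedding_iff', c.mem_range_embedding_iff]
  exact ⟨fun h => h.1, fun h => ⟨h, lt_of_le_of_lt hij (c.lt_sizeUpTo_index_succ j)⟩⟩

theorem mem_boundaries_iff {b : Fin (n + 1)} :
    b ∈ c.boundaries ↔ ∃ k ≤ c.length, c.sizeUpTo k = b := by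
  rw [Composition.boundaries, Finset.mem_map]
  constructor
  · rintro ⟨k, -, rfl⟩
    exact ⟨k, Nat.lt_succ_iff.mp k.is_lt, rfl⟩
  · rintro ⟨k, hk, h⟩
    exact ⟨⟨k, Nat.lt_succ_iff.mpr hk⟩, mem_univ _, Fin.ext h⟩

theorem index_eq_iff_forall_notMem_boundaries {i j : Fin n} (hij : i ≤ j) :
    c.index i = c.index j ↔ ∀ b : Fin (n + 1), (i : ℕ) < b → (b : ℕ) ≤ j → b ∉ c.boundaries := by
  rw [index_eq_iff_sizeUpTo_le c hij]
  constructor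
  · intro h b hib hbj hb
    obtain ⟨k, -, hk⟩ := (mem_boundaries_iff c).mp hb
    have hj : (j : ℕ) < c.sizeUpTo ((c.index j : ℕ) + 1) := c.lt_sizeUpTo_index_succ j
    rcases Nat.lt_or_ge (c.index j) k with h1 | h1
    · have := c.monotone_sizeUpTo (Nat.succ_le_of_lt h1)
      simp only [Nat.succ_eq_add_one] at this
      omega
    · have := c.monotone_sizeUpTo h1
      omega
  · intro h
    by_contra hc
    have hle := c.sizeUpTo_index_le j
    refine h ⟨c.sizeUpTo (c.index j), by omega⟩ (by simpa using hc) hle ?_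
    exact (mem_boundaries_iff c).mpr ⟨c.index j, (c.index j).is_lt.le, rfl⟩

/-- For fixed j the earlier members of its block telescope to (1 - t)/(1 - t^(p+1)), with p the
position of j in the block counted from 0. Over a block of size m these are the inverses of the
factors of [m]_t!. -/
theorem prod_same_block {K : Type*} [Field K] (t : K) (ht : ∀ k : ℕ, t ^ (k + 1) ≠ 1) :
    ∏ j : Fin n, ∏ i : Fin n, (if i < j ∧ c.index i = c.index j then
      (1 - t ^ ((j : ℕ) - i)) / (1 - t ^ ((j : ℕ) - i + 1)) else 1) =
      (c.blocks.map fun m => ∏ i ∈ Icc 1 m, (1 - t ^ i) / (1 - t)).prod⁻¹ := by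
  have hinner : ∀ j : Fin n, ∏ i : Fin n, (if i < j ∧ c.index i = c.index j then
      (1 - t ^ ((j : ℕ) - i)) / (1 - t ^ ((j : ℕ) - i + 1)) else 1) =
      (1 - t) / (1 - t ^ ((c.invEmbedding j : ℕ) + 1)) := by
    intro j
    have hle := c.sizeUpTo_index_le j
    set s := c.sizeUpTo (c.index j) with hs
    rw [c.coe_invEmbedding, ← hs, ← prod_range_one_sub_pow_div t ht ((j : ℕ) - s), ← prod_filter]
    refine prod_bij' (fun i _ => (i : ℕ) - s)
      (fun i hi => ⟨s + i, by have := mem_range.mp hi; omega⟩) ?_ ?_ ?_ ?_ ?_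
    · intro i hi
      obtain ⟨-, h1, h2⟩ := mem_filter.mp hi
      rw [index_eq_iff_sizeUpTo_le c h1.le] at h2
      rw [mem_range]
      have : (i : ℕ) < j := h1
      omega
    · intro i hi
      have h := mem_range.mp hi
      rw [mem_filter]
      have hlt : (⟨s + i, by omega⟩ : Fin n) < j := by
        rw [Fin.lt_def]
        simp only
        omega
      exact ⟨mem_univ _, hlt, (index_eq_iff_sizeUpTo_le c hlt.le).mpr (by simp [← hs])⟩
    · intro i hi
      obtain ⟨-, h1, h2⟩ := mem_filter.mp hi
      rw [index_eq_iff_sizeUpTo_le c h1.le] at h2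
      ext
      simp only
      omega
    · intro i hi
      simp
    · intro i hi
      obtain ⟨-, h1, h2⟩ := mem_filter.mp hi
      rw [index_eq_iff_sizeUpTo_le c h1.le] at h2
      have : (j : ℕ) - s - ((i : ℕ) - s) = j - i := by omega
      rw [this]
  rw [prod_congr rfl fun j _ => hinner j, ← c.ofFn_blocksFun, List.map_ofFn, List.prod_ofFn,
    ← prod_inv_distrib, ← c.prod_prod_apply_embedding]
  refine prod_congr rfl fun k _ => ?_
  simp only [Function.comp]
  rw [← prod_inv_distrib, ← Finset.Ico_add_one_right_eq_Icc, prod_Ico_eq_prod_range,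
    Nat.add_sub_cancel, prod_range]
  refine prod_congr rfl fun j _ => ?_
  rw [c.invEmbedding_comp, inv_div, add_comm]

end Compositions

/-! ### Valuations and monomials in ℚ(q)((t)) -/

section LaurentField

theorem t_ne_zero : t ≠ 0 := by
  rw [t, Ne, HahnSeries.single_eq_zero_iff]
  exact one_ne_zero

theorem q_ne_zero : q ≠ 0 := by
  rw [q, Ne, map_eq_zero]
  exact RatFunc.X_ne_zero

theorem valuation_t : Valued.v t = WithZero.exp (-1 : ℤ) := by
  rw [t, LaurentSeries.valuation_single_zpow]

theorem valuation_C_le_one (r : RatFunc ℚ) : Valued.v (HahnSeries.C r : Kqt) ≤ 1 :=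
  (LaurentSeries.val_le_one_iff_eq_coe _ _).mpr ⟨PowerSeries.C r, PowerSeries.coe_C r⟩

theorem valuation_q_zpow (d : ℤ) : Valued.v (q ^ d) = 1 := by
  have h1 : Valued.v q ≤ 1 := valuation_C_le_one _
  have h2 : (Valued.v q)⁻¹ ≤ 1 := by
    rw [← map_inv₀, q, ← map_inv₀]
    exact valuation_C_le_one _
  have h0 : 0 < Valued.v q := by simpa [zero_lt_iff] using q_ne_zero
  have : Valued.v q = 1 := le_antisymm h1 ((inv_le_one₀ h0).mp h2)
  rw [map_zpow₀, this, one_zpow]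

theorem valuation_t_lt_one : Valued.v t < 1 := by
  rw [valuation_t]
  exact compareOfLessAndEq_eq_lt.mp rfl

theorem tendsto_t_pow : Tendsto (fun k : ℕ => t ^ k) atTop (𝓝 0) :=
  Valued.tendsto_zero_pow_of_v_lt_one valuation_t_lt_one

theorem q_zpow_mul_t_zpow (d c : ℤ) :
    q ^ d * t ^ c = (HahnSeries.single c (RatFunc.X ^ d) : Kqt) := by
  rw [q, t, ← map_zpow₀, ← RatFunc.single_zpow, HahnSeries.C_apply, HahnSeries.single_mul_single,
    zero_add, mul_one]

theorem ratFunc_X_pow_ne_one (k : ℕ) : (RatFunc.X : RatFunc ℚ) ^ (k + 1) ≠ 1 := by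
  have h : ∀ k : ℕ, ((RatFunc.X : RatFunc ℚ) ^ k).intDegree = k := by
    intro k
    induction k with
    | zero => simp
    | succ k ih =>
      rw [pow_succ, RatFunc.intDegree_mul (pow_ne_zero _ RatFunc.X_ne_zero) RatFunc.X_ne_zero, ih,
        RatFunc.intDegree_X]
      push_cast
      rfl
  intro h1
  have := h (k + 1)
  rw [h1, RatFunc.intDegree_one] at this
  push_cast at this
  omega

theorem ratFunc_X_zpow_injective :
    Function.Injective fun d : ℤ => (RatFunc.X : RatFunc ℚ) ^ d := by
  have key : ∀ d e : ℤ, d < e → (RatFunc.X : RatFunc ℚ) ^ d ≠ RatFunc.X ^ e := by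
    intro d e hde h
    have h1 : (RatFunc.X : RatFunc ℚ) ^ (e - d) = 1 := by
      rw [zpow_sub₀ RatFunc.X_ne_zero, h, div_self (zpow_ne_zero _ RatFunc.X_ne_zero)]
    obtain ⟨k, hk⟩ := Int.eq_ofNat_of_zero_le (show 0 ≤ e - d - 1 by omega)
    have h2 : e - d = ((k + 1 : ℕ) : ℤ) := by push_cast; omega
    rw [h2, zpow_natCast] at h1
    exact ratFunc_X_pow_ne_one k h1
  intro d e h
  rcases lt_trichotomy d e with h' | h' | h'
  · exact absurd h (key d e h')
  · exact h'
  · exact absurd h.symm (key e d h')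

/-- The order in t recovers the exponent of t, and the coefficient, a power of the transcendental q,
recovers the other. -/
theorem q_zpow_mul_t_zpow_inj {d c d' c' : ℤ} :
    q ^ d * t ^ c = q ^ d' * t ^ c' ↔ d = d' ∧ c = c' := by
  refine ⟨fun h => ?_, fun h => by rw [h.1, h.2]⟩
  rw [q_zpow_mul_t_zpow, q_zpow_mul_t_zpow] at h
  have hne : ∀ d : ℤ, (RatFunc.X : RatFunc ℚ) ^ d ≠ 0 := fun d => zpow_ne_zero _ RatFunc.X_ne_zero
  have hc : c = c' := by
    have := congrArg HahnSeries.orderTop h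
    rw [HahnSeries.orderTop_single (hne d), HahnSeries.orderTop_single (hne d')] at this
    exact_mod_cast this
  subst hc
  exact ⟨ratFunc_X_zpow_injective (HahnSeries.single_injective c h), rfl⟩

theorem t_pow_succ_ne_one (k : ℕ) : t ^ (k + 1) ≠ 1 := by
  intro h
  have h1 : q ^ (0 : ℤ) * t ^ ((k + 1 : ℕ) : ℤ) = q ^ (0 : ℤ) * t ^ (0 : ℤ) := by
    rw [zpow_natCast, h, zpow_zero, zpow_zero]
  have := (q_zpow_mul_t_zpow_inj.mp h1).2
  push_cast at this
  omega

theorem valuation_t_zpow_le_one {c : ℤ} (hc : 0 ≤ c) : Valued.v (t ^ c) ≤ 1 := by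
  obtain ⟨k, rfl⟩ := Int.eq_ofNat_of_zero_le hc
  rw [zpow_natCast, map_pow]
  exact pow_le_one' valuation_t_lt_one.le k

theorem valuation_one_sub_le_one (d : ℤ) {c : ℤ} (hc : 0 ≤ c) :
    Valued.v (1 - q ^ d * t ^ c) ≤ 1 := by
  refine (Valuation.map_sub _ _ _).trans (max_le (by rw [map_one]) ?_)
  rw [map_mul, valuation_q_zpow, one_mul]
  exact valuation_t_zpow_le_one hc

theorem valuation_one_sub_eq_one (d : ℤ) {c : ℤ} (hc : 0 < c) :
    Valued.v (1 - q ^ d * t ^ c) = 1 := by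
  have h : Valued.v (q ^ d * t ^ c) < 1 := by
    rw [map_mul, valuation_q_zpow, one_mul, ← sub_add_cancel c 1, zpow_add_one₀ t_ne_zero, map_mul]
    exact lt_of_le_of_lt (mul_le_of_le_one_left' (valuation_t_zpow_le_one (by omega)))
      valuation_t_lt_one
  exact Valuation.map_one_sub_of_lt _ h

end LaurentField

/-! ### Horizontal strips and the standard order of the boxes -/

section Order

variable {D : Set (ℕ × ℕ)} {T : D → ℕ}

/-- `T` is weakly decreasing along the rows and strictly decreasing along the columns of the
lower set `D`. -/
structure IsColStrict (T : D → ℕ) : Prop where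
  lower : IsLowerSet D
  row_weak : ∀ b b' : D, b.1.1 = b'.1.1 → b.1.2 < b'.1.2 → T b' ≤ T b
  col_strict : ∀ b b' : D, b.1.2 = b'.1.2 → b.1.1 < b'.1.1 → T b' < T b

namespace IsColStrict

/-- Boxes with the same value of `T` form a horizontal strip. -/
theorem row_le (hT : IsColStrict T) {b b' : D} (h : T b = T b') (hc : b.1.2 < b'.1.2) :
    b'.1.1 ≤ b.1.1 := by
  by_contra hr
  have hmem : (b.1.1, b'.1.2) ∈ D :=
    hT.lower (show (b.1.1, b'.1.2) ≤ b'.1 from ⟨(not_le.mp hr).le, le_rfl⟩) b'.2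
  have h1 := hT.row_weak b ⟨_, hmem⟩ rfl hc
  have h2 := hT.col_strict ⟨_, hmem⟩ b' rfl (not_le.mp hr)
  omega

theorem eq_of_col_eq (hT : IsColStrict T) {b b' : D} (h : T b = T b') (hc : b.1.2 = b'.1.2) :
    b = b' := by
  rcases lt_trichotomy b.1.1 b'.1.1 with hr | hr | hr
  · have := hT.col_strict b b' hc hr
    omega
  · exact Subtype.ext (Prod.ext hr hc)
  · have := hT.col_strict b' b hc.symm hr
    omega

theorem precedes_iff_col_lt (hT : IsColStrict T) {b b' : D} (h : T b = T b') :
    Precedes T b b' ↔ b.1.2 < b'.1.2 := by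
  refine ⟨?_, fun hc => Or.inr ⟨h, Or.inl hc⟩⟩
  rintro (h' | ⟨-, hc | ⟨hc, hr⟩⟩)
  · omega
  · exact hc
  · have := hT.eq_of_col_eq h hc
    rw [this] at hr
    exact absurd hr (lt_irrefl _)

theorem content_lt (hT : IsColStrict T) {b b' : D} (h : T b = T b') (hc : b.1.2 < b'.1.2) :
    content b.1 < content b'.1 := by
  have := hT.row_le h hc
  unfold content
  omega

/-- In a horizontal strip, moving right to another row also moves up, so the content jumps by at
least 2. Thus a content difference of 1 forces a common row. -/
theorem content_add_one_lt (hT : IsColStrict T) {b b' : D} (h : T b = T b') (hc : b.1.2 < b'.1.2)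
    (hr : b.1.1 ≠ b'.1.1) : content b.1 + 1 < content b'.1 := by
  have := hT.row_le h hc
  unfold content
  omega

theorem eq_of_content_eq (hT : IsColStrict T) {b b' : D} (h : T b = T b')
    (hc : content b.1 = content b'.1) :
    b = b' := by
  rcases lt_trichotomy b.1.2 b'.1.2 with h' | h' | h'
  · exact absurd hc (hT.content_lt h h').ne
  · exact hT.eq_of_col_eq h h'
  · have hlt := hT.content_lt h.symm h'
    exact absurd hc.symm hlt.ne

/-- The box to the right of `b` has the same value of `T` if a later box of its row has. -/
theorem exists_right (hT : IsColStrict T) {b b' : D} (h : T b = T b') (hr : b.1.1 = b'.1.1)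
    (hc : b.1.2 < b'.1.2) :
    ∃ b'' : D, b''.1.1 = b.1.1 ∧ b''.1.2 = b.1.2 + 1 ∧ T b'' = T b := by
  have hmem : (b.1.1, b.1.2 + 1) ∈ D :=
    hT.lower (show (b.1.1, b.1.2 + 1) ≤ b'.1 from ⟨hr.le, hc⟩) b'.2
  refine ⟨⟨_, hmem⟩, rfl, rfl, le_antisymm (hT.row_weak b _ rfl (Nat.lt_succ_self _)) ?_⟩
  rcases (Nat.succ_le_of_lt hc).eq_or_lt with h' | h'
  · have : b' = ⟨_, hmem⟩ := Subtype.ext (Prod.ext hr.symm h'.symm)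
    rw [← this, h]
  · exact h.le.trans (hT.row_weak _ b' hr h')

end IsColStrict

theorem precedes_irrefl (b : D) : ¬ Precedes T b b := by
  rintro (h | ⟨-, h | ⟨-, h⟩⟩) <;> exact lt_irrefl _ h

theorem Precedes.trans {a b c : D} (h1 : Precedes T a b) (h2 : Precedes T b c) :
    Precedes T a c := by
  unfold Precedes ColBefore at *
  omega

theorem precedes_trichotomy (b b' : D) : Precedes T b b' ∨ b = b' ∨ Precedes T b' b := by
  by_cases h : b.1.2 = b'.1.2 ∧ b.1.1 = b'.1.1
  · exact Or.inr (Or.inl (Subtype.ext (Prod.ext h.2 h.1)))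
  · unfold Precedes ColBefore
    omega

/-- Finiteness of initial segments is essential: `ncard` of an infinite set is 0. -/
theorem stdLabel_lt_of_precedes (hfin : ∀ b : D, {b' | Precedes T b' b}.Finite) {b b' : D}
    (h : Precedes T b b') : stdLabel T b < stdLabel T b' := by
  unfold stdLabel
  refine Nat.succ_lt_succ (Set.ncard_lt_ncard ⟨fun a ha => Precedes.trans ha h, fun hs => ?_⟩
    (hfin b'))
  exact precedes_irrefl b (hs h)

theorem stdLabel_lt_iff (hfin : ∀ b : D, {b' | Precedes T b' b}.Finite) {b b' : D} :
    stdLabel T b < stdLabel T b' ↔ Precedes T b b' := by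
  refine ⟨fun h => ?_, stdLabel_lt_of_precedes hfin⟩
  rcases precedes_trichotomy (T := T) b b' with h' | h' | h'
  · exact h'
  · rw [h'] at h; exact absurd h (lt_irrefl _)
  · exact absurd (stdLabel_lt_of_precedes hfin h') h.not_gt

theorem stdLabel_injective (hfin : ∀ b : D, {b' | Precedes T b' b}.Finite) :
    Function.Injective (stdLabel T) := by
  intro b b' h
  rcases precedes_trichotomy (T := T) b b' with h' | h' | h'
  · exact absurd h (stdLabel_lt_of_precedes hfin h').ne
  · exact h'
  · exact absurd h (stdLabel_lt_of_precedes hfin h').ne'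

/-- An injective labelling of an infinite set is unbounded, and by counting, the predecessors of a
box take all smaller labels. -/
theorem exists_stdLabel_eq [Infinite D] (hfin : ∀ b : D, {b' | Precedes T b' b}.Finite) (k : ℕ) :
    ∃ b : D, stdLabel T b = k + 1 := by
  obtain ⟨b, hb⟩ : ∃ b : D, k + 1 ≤ stdLabel T b := by
    by_contra hc
    push Not at hc
    exact Set.infinite_range_of_injective (stdLabel_injective hfin)
      ((Set.finite_lt_nat (k + 1)).subset (by rintro _ ⟨b, rfl⟩; exact hc b))
  rcases hb.eq_or_lt with hb | hb
  · exact ⟨b, hb.symm⟩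
  have hcard : #(hfin b).toFinset = stdLabel T b - 1 := by
    rw [← Set.ncard_eq_toFinset_card _ (hfin b)]
    rfl
  have himg : (hfin b).toFinset.image (stdLabel T) = Ico 1 (stdLabel T b) := by
    refine eq_of_subset_of_card_le ?_ ?_
    · intro l hl
      obtain ⟨b', hb', rfl⟩ := mem_image.mp hl
      have hb' : Precedes T b' b := (Set.Finite.mem_toFinset (hfin b)).mp hb'
      rw [mem_Ico]
      exact ⟨Nat.succ_le_succ (Nat.zero_le _), stdLabel_lt_of_precedes hfin hb'⟩
    · rw [card_image_of_injective _ (stdLabel_injective hfin), hcard, Nat.card_Ico]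
  have : k + 1 ∈ Ico 1 (stdLabel T b) := mem_Ico.mpr ⟨by omega, hb⟩
  rw [← himg] at this
  obtain ⟨a, -, h⟩ := mem_image.mp this
  exact ⟨a, h⟩

/-- The boxes of an infinite diagram in the order `Precedes T`. -/
noncomputable def stdEquiv [Infinite D] (hfin : ∀ b : D, {b' | Precedes T b' b}.Finite) : ℕ ≃ D :=
  (Equiv.ofBijective (fun b : D => stdLabel T b - 1)
    ⟨fun b b' h => stdLabel_injective hfin (by
      simp only [stdLabel, Nat.add_sub_cancel] at h ⊢
      omega), fun k => (exists_stdLabel_eq hfin k).imp fun b h => by simp [h]⟩).symm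

theorem stdLabel_stdEquiv [Infinite D] (hfin : ∀ b : D, {b' | Precedes T b' b}.Finite) (k : ℕ) :
    stdLabel T (stdEquiv hfin k) = k + 1 := by
  have h : stdLabel T (stdEquiv hfin k) - 1 = k := (stdEquiv hfin).symm_apply_apply k
  have h1 : 1 ≤ stdLabel T (stdEquiv hfin k) := Nat.succ_le_succ (Nat.zero_le _)
  omega

theorem precedes_stdEquiv_iff [Infinite D] (hfin : ∀ b : D, {b' | Precedes T b' b}.Finite)
    {i j : ℕ} : Precedes T (stdEquiv hfin i) (stdEquiv hfin j) ↔ i < j := by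
  rw [← stdLabel_lt_iff hfin, stdLabel_stdEquiv, stdLabel_stdEquiv]
  omega

end Order

end VVMac

namespace VVMac

open Finset Filter Topology

/-! ### The diagrams λ^(n) and λ^(∞) -/

section Padding

variable {lam : YoungDiagram}

theorem mem_pad_iff {n : ℕ} (hn : nMin lam ≤ n) {b : ℕ × ℕ} :
    b ∈ boxes (pad lam n) ↔
      (b.1 = 0 ∧ b.2 < n - lam.card) ∨ (1 ≤ b.1 ∧ (b.1 - 1, b.2) ∈ lam) := by
  obtain ⟨i, j⟩ := b
  have hmax : max (n - lam.card) (lam.rowLen 0) = n - lam.card :=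
    max_eq_left (by unfold nMin at hn; omega)
  simp only [boxes, pad, hmax, coe_union, Set.mem_union, mem_coe, mem_product, mem_singleton,
    Finset.mem_range, mem_image, Prod.mk.injEq, YoungDiagram.mem_cells, Prod.exists]
  refine or_congr Iff.rfl ⟨?_, fun ⟨h1, h2⟩ => ⟨i - 1, j, h2, by omega, rfl⟩⟩
  rintro ⟨a, b, hab, rfl, rfl⟩
  exact ⟨by omega, by simpa using hab⟩

theorem mem_padInf_iff {b : ℕ × ℕ} :
    b ∈ padInf lam ↔ b.1 = 0 ∨ (1 ≤ b.1 ∧ (b.1 - 1, b.2) ∈ lam) := by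
  simp only [padInf, Set.mem_iUnion, exists_prop]
  constructor
  · rintro ⟨n, hn, hb⟩
    exact ((mem_pad_iff hn).mp hb).imp (fun h => h.1) id
  · intro h
    refine ⟨nMin lam + b.2 + 1, by omega,
      (mem_pad_iff (by omega)).mpr (h.imp (fun h => ⟨h, ?_⟩) id)⟩
    unfold nMin
    omega

theorem isLowerSet_padInf : IsLowerSet (padInf lam) := by
  intro b b' hle hb
  rw [mem_padInf_iff] at hb ⊢
  obtain ⟨h1, h2⟩ := hle
  rcases Nat.eq_zero_or_pos b'.1 with h | h
  · exact Or.inl h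
  · rcases hb with hb | ⟨hb, hm⟩
    · omega
    · exact Or.inr ⟨h, lam.up_left_mem (by omega) h2 hm⟩

theorem col_lt_of_mem {i j : ℕ} (h : (i, j) ∈ lam) : j < lam.rowLen 0 :=
  YoungDiagram.mem_iff_lt_rowLen.mp (lam.up_left_mem (Nat.zero_le i) le_rfl h)

theorem card_pad {n : ℕ} (hn : nMin lam ≤ n) : (pad lam n).card = n := by
  have hmax : max (n - lam.card) (lam.rowLen 0) = n - lam.card :=
    max_eq_left (by unfold nMin at hn; omega)
  have hle : lam.card ≤ n := by unfold nMin at hn; omega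
  rw [YoungDiagram.card, pad]
  simp only [hmax]
  rw [card_union_of_disjoint, card_product, card_singleton, card_range, card_image_of_injective]
  · change 1 * (n - lam.card) + lam.card = n
    omega
  · rintro ⟨a, b⟩ ⟨c, d⟩ h
    simpa using h
  · rw [disjoint_left]
    rintro ⟨i, j⟩ h1 h2
    obtain ⟨b, -, h⟩ := mem_image.mp h2
    simp only [mem_product, mem_singleton, Prod.mk.injEq] at h1 h
    omega

instance infinite_padInf : Infinite (padInf lam) :=
  Infinite.of_injective (fun k : ℕ => (⟨(0, k), mem_padInf_iff.mpr (Or.inl rfl)⟩ : padInf lam))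
    fun k l h => by simpa using h

theorem finite_preimage_pad (n : ℕ) :
    {b : padInf lam | b.1 ∈ boxes (pad lam n)}.Finite :=
  (finite_toSet (pad lam n).cells).preimage Subtype.val_injective.injOn

/-- Only the first row is infinite, and contents grow along it. -/
theorem finite_content_le (c : ℤ) : {b : padInf lam | content b.1 ≤ c}.Finite := by
  refine (finite_preimage_pad (nMin lam + c.toNat + 1)).subset fun b hb => ?_
  refine (mem_pad_iff (by omega)).mpr ((mem_padInf_iff.mp b.2).imp (fun h => ⟨h, ?_⟩) id)
  have hb : content b.1 ≤ c := hb
  unfold content at hb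
  unfold nMin
  omega

end Padding

/-! ### Enumeration of the boxes determined by T -/

namespace Omega

variable {lam : YoungDiagram} (T : Omega lam)

theorem isColStrict : IsColStrict T.val := ⟨isLowerSet_padInf, T.row_weak, T.col_strict⟩

theorem isColStrict_restrict (n : ℕ) : IsColStrict (T.restrict n) :=
  ⟨(pad lam n).isLowerSet, fun _ _ h1 h2 => T.row_weak _ _ h1 h2,
    fun _ _ h1 h2 => T.col_strict _ _ h1 h2⟩

theorem rk_spec : nMin lam ≤ T.rk ∧
    ∀ b : padInf lam, b.1 ∉ boxes (pad lam T.rk) → T.val b = 0 := by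
  refine Nat.sInf_mem (s := {n | nMin lam ≤ n ∧
    ∀ b : padInf lam, b.1 ∉ boxes (pad lam n) → T.val b = 0}) ?_
  obtain ⟨M, hM⟩ := (T.finite_support.image fun b => b.1.2).bddAbove
  refine ⟨nMin lam + M + 1, by omega, fun b hb => ?_⟩
  by_contra hc
  refine hb ((mem_pad_iff (by omega)).mpr ((mem_padInf_iff.mp b.2).imp (fun h => ⟨h, ?_⟩) id))
  have : b.1.2 ≤ M := hM ⟨b, hc, rfl⟩
  unfold nMin
  omega

/-- A predecessor either lies in the support of T or has T = 0 and is no further right than b, which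
bounds its content. -/
theorem finite_precedes (b : padInf lam) : {b' | Precedes T.val b' b}.Finite := by
  refine (T.finite_support.union (finite_content_le (b.1.2 : ℤ))).subset fun b' hb' => ?_
  by_cases h : T.val b' = 0
  · right
    have hb' : Precedes T.val b' b := hb'
    change content b'.1 ≤ _
    unfold content
    unfold Precedes ColBefore at hb'
    omega
  · exact Or.inl h

/-- The boxes of `λ^{(∞)}` in the order defined by `T`. -/
noncomputable def box : ℕ ≃ padInf lam := stdEquiv T.finite_precedes

theorem precedes_box_iff {i j : ℕ} : Precedes T.val (T.box i) (T.box j) ↔ i < j :=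
  precedes_stdEquiv_iff T.finite_precedes

/-- T vanishes at this box, so its predecessors are the boxes with T > 0, all in λ^(rk T), and the
zero boxes in columns to its left. Together they form λ^(rk T + k), which has rk T + k boxes. -/
theorem box_tail (k : ℕ) : (T.box (T.rk + k)).1 = (0, T.rk - lam.card + k) := by
  obtain ⟨hn, hvan⟩ := T.rk_spec
  have hcard : lam.card + lam.rowLen 0 ≤ T.rk := hn
  have hmem : (0, T.rk - lam.card + k) ∈ padInf lam := mem_padInf_iff.mpr (Or.inl rfl)
  set b : padInf lam := ⟨_, hmem⟩ with hb
  have hTb : T.val b = 0 := by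
    refine hvan b fun h => ?_
    rcases (mem_pad_iff hn).mp h with ⟨-, h⟩ | ⟨h, -⟩
    · simp only [hb] at h
      omega
    · simp [hb] at h
  have hset : {b' | Precedes T.val b' b} = Subtype.val ⁻¹' boxes (pad lam (T.rk + k)) := by
    ext b'
    rw [Set.mem_preimage, mem_pad_iff (by omega)]
    change Precedes T.val b' b ↔ _
    unfold Precedes ColBefore
    rw [hTb]
    constructor
    · rintro (h | ⟨-, h⟩)
      · have : b'.1 ∈ boxes (pad lam T.rk) := by
          by_contra hc
          rw [hvan b' hc] at h
          exact lt_irrefl _ h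
        rw [mem_pad_iff hn] at this
        refine this.imp (fun h => ⟨h.1, ?_⟩) id
        omega
      · refine (mem_padInf_iff.mp b'.2).imp (fun h' => ⟨h', ?_⟩) id
        simp only [hb] at h
        omega
    · intro h
      rcases Nat.eq_zero_or_pos (T.val b') with h0 | h0
      · refine Or.inr ⟨h0, Or.inl ?_⟩
        rcases h with ⟨-, h⟩ | ⟨-, h⟩
        · simp only [hb]
          omega
        · have := col_lt_of_mem h
          simp only [hb]
          omega
      · exact Or.inl h0
  have hlabel : stdLabel T.val b = T.rk + k + 1 := by
    rw [stdLabel, hset, Set.ncard_preimage_of_injective_subset_range Subtype.val_injective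
      (by rw [Subtype.range_coe]; exact pad_subset_padInf lam _), boxes, Set.ncard_coe_finset]
    exact congrArg (· + 1) (card_pad (by omega))
  have : T.box (T.rk + k) = b := stdLabel_injective T.finite_precedes (by
    rw [hlabel]
    exact stdLabel_stdEquiv _ _)
  rw [this]

theorem box_mem_pad_iff (i : ℕ) : (T.box i).1 ∈ boxes (pad lam T.rk) ↔ i < T.rk := by
  obtain ⟨hn, hvan⟩ := T.rk_spec
  constructor
  · intro h
    by_contra hc
    obtain ⟨k, rfl⟩ := Nat.exists_eq_add_of_le (not_lt.mp hc)
    rw [box_tail, mem_pad_iff hn] at h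
    simp only at h
    omega
  · intro hi
    by_contra hc
    have h0 : (T.box i).1.1 = 0 ∧ T.rk - lam.card ≤ (T.box i).1.2 := by
      rw [mem_pad_iff hn] at hc
      have := mem_padInf_iff.mp (T.box i).2
      push Not at hc
      rcases this with h | h
      · exact ⟨h, hc.1 h⟩
      · exact absurd h.2 (hc.2 h.1)
    have : T.box i = T.box (T.rk + ((T.box i).1.2 - (T.rk - lam.card))) := by
      refine Subtype.ext ?_
      rw [box_tail]
      refine Prod.ext h0.1 ?_
      simp only
      omega
    have := T.box.injective this
    omega

end Omega

/-! ### The nodes q^T t^c and the size of the weights -/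

section Nodes

variable {D : Set (ℕ × ℕ)} {T : D → ℕ}

/-- The monomial `q^{T(b)} t^{c(b)}`. -/
noncomputable def node (T : D → ℕ) (b : D) : Kqt := q ^ (T b : ℤ) * t ^ content b.1

theorem node_ne_zero (b : D) : node T b ≠ 0 :=
  mul_ne_zero (zpow_ne_zero _ q_ne_zero) (zpow_ne_zero _ t_ne_zero)

theorem node_div_node (b b' : D) :
    node T b' / node T b = q ^ ((T b' : ℤ) - T b) * t ^ (content b'.1 - content b.1) := by
  rw [node, node, zpow_sub₀ q_ne_zero, zpow_sub₀ t_ne_zero, mul_div_mul_comm]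

theorem pairFactor_eq (p : D × D) (k : ℤ) :
    pairFactor T p k = 1 - node T p.2 / node T p.1 * t ^ k := by
  rw [pairFactor, node_div_node, zpow_add₀ t_ne_zero, mul_assoc]

theorem node_eq_t_mul_iff {b b' : D} :
    node T b' = t * node T b ↔ T b' = T b ∧ content b'.1 = content b.1 + 1 := by
  have : t * node T b = q ^ (T b : ℤ) * t ^ (content b.1 + 1) := by
    rw [node, zpow_add_one₀ t_ne_zero]
    ring
  rw [this, node, q_zpow_mul_t_zpow_inj, Nat.cast_inj]

theorem node_injective (hT : IsColStrict T) : Function.Injective (node T) := by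
  intro b b' h
  rw [node, node, q_zpow_mul_t_zpow_inj, Nat.cast_inj] at h
  exact hT.eq_of_content_eq h.1 h.2

theorem node_ne_t_mul (hT : IsColStrict T) {b b' : D} (h : Precedes T b b') :
    node T b ≠ t * node T b' := by
  rw [Ne, node_eq_t_mul_iff]
  rintro ⟨h1, h2⟩
  have := hT.content_lt h1 ((hT.precedes_iff_col_lt h1).mp h)
  omega

/-- When the content increases, the numerator has a nonnegative power of t and the denominator is 1
minus a multiple of t, hence a unit; the prefactor t remains. -/
theorem valuation_invWeight_le {b b' : D} (h : content b.1 < content b'.1) :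
    Valued.v (invWeight t (node T b) (node T b')) ≤ Valued.v t := by
  have h1 : 1 - node T b' / node T b * t⁻¹ =
      1 - q ^ ((T b' : ℤ) - T b) * t ^ (content b'.1 - content b.1 - 1) := by
    rw [node_div_node, zpow_sub_one₀ t_ne_zero, mul_assoc]
  have h2 : 1 - node T b' / node T b * t =
      1 - q ^ ((T b' : ℤ) - T b) * t ^ (content b'.1 - content b.1 + 1) := by
    rw [node_div_node, zpow_add_one₀ t_ne_zero, mul_assoc]
  have hpos : 0 < content b'.1 - content b.1 + 1 := by omega
  rw [invWeight, h1, h2, map_mul, map_div₀, valuation_one_sub_eq_one _ hpos, div_one]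
  exact mul_le_of_le_one_right' (valuation_one_sub_le_one _ (by omega))

end Nodes

/-! ### Tableaux as straight permutations, and the series side -/

section Series

variable {lam : YoungDiagram} (T : Omega lam)

/-- The permutation of `ℕ` that describes `τ` in terms of the standard order of the boxes. -/
noncomputable def APSYTOver.perm {T : Omega lam} (τ : APSYTOver T) : Equiv.Perm ℕ :=
  Equiv.ofBijective (fun i => (τ.1.label (T.box i)).idx - 1) <| by
    have hpos := τ.1.idx_pos
    constructor
    · intro i j h
      have hi := hpos (T.box i)
      have hj := hpos (T.box j)
      obtain ⟨b, -, hb⟩ := τ.1.existsUnique_idx _ hi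
      exact T.box.injective ((hb _ rfl).trans (hb _ (by simp only at h; omega)).symm)
    · intro k
      obtain ⟨b, hb, -⟩ := τ.1.existsUnique_idx (k + 1) (by omega)
      exact ⟨T.box.symm b, by simp [hb]⟩

theorem APSYTOver.idx_eq {T : Omega lam} (τ : APSYTOver T) (i : ℕ) :
    (τ.1.label (T.box i)).idx = τ.perm i + 1 := by
  have := τ.1.idx_pos (T.box i)
  change _ = (τ.1.label (T.box i)).idx - 1 + 1
  omega

theorem APSYTOver.exp_eq {T : Omega lam} (τ : APSYTOver T) (b : padInf lam) :
    (τ.1.label b).exp = T.val b := congrFun τ.2 b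

/-- The relation x_j = t x_i means equal T and content larger by 1, hence a common row, along which
the numbers increase. -/
theorem APSYTOver.straight_perm {T : Omega lam} (τ : APSYTOver T) :
    Straight t (fun i => node T.val (T.box i)) τ.perm := by
  intro i j hij h
  obtain ⟨h1, h2⟩ := node_eq_t_mul_iff.mp h
  have hc := (T.isColStrict.precedes_iff_col_lt h1.symm).mp (T.precedes_box_iff.mpr hij)
  have hr : (T.box i).1.1 = (T.box j).1.1 := by
    by_contra hr
    have := T.isColStrict.content_add_one_lt h1.symm hc hr
    omega
  rcases τ.1.strict.1 _ _ hr hc with h' | ⟨-, h'⟩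
  · rw [τ.exp_eq, τ.exp_eq] at h'
    omega
  · rw [τ.idx_eq, τ.idx_eq] at h'
    omega

theorem APSYTOver.perm_injective : Function.Injective (APSYTOver.perm (T := T)) := by
  intro τ τ' h
  have hl : τ.1.label = τ'.1.label := by
    funext b
    obtain ⟨i, rfl⟩ := T.box.surjective b
    ext
    · rw [τ.idx_eq, τ'.idx_eq, h]
    · rw [τ.exp_eq, τ'.exp_eq]
  obtain ⟨⟨l, _, _, _, _⟩, _⟩ := τ
  obtain ⟨⟨l', _, _, _, _⟩, _⟩ := τ'
  simp only at hl
  subst hl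
  rfl

/-- Straightness compares only neighbours; the boxes in between carry the same T, so the comparisons
chain. -/
theorem Straight.lt_of_same_row {T : Omega lam} {π : Equiv.Perm ℕ}
    (hπ : Straight t (fun i => node T.val (T.box i)) π) (d : ℕ) :
    ∀ b b' : padInf lam, T.val b = T.val b' → b.1.1 = b'.1.1 → b'.1.2 = b.1.2 + d + 1 →
      π (T.box.symm b) < π (T.box.symm b') := by
  have hadj : ∀ b b' : padInf lam, T.val b' = T.val b → b'.1.1 = b.1.1 → b'.1.2 = b.1.2 + 1 →
      π (T.box.symm b) < π (T.box.symm b') := by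
    intro b b' h1 h2 h3
    refine hπ _ _ ?_ ?_
    · rw [← T.precedes_box_iff, Equiv.apply_symm_apply, Equiv.apply_symm_apply,
        T.isColStrict.precedes_iff_col_lt h1.symm]
      omega
    · simp only [Equiv.apply_symm_apply]
      refine node_eq_t_mul_iff.mpr ⟨h1, ?_⟩
      unfold content
      omega
  induction d with
  | zero => intro b b' h1 h2 h3; exact hadj b b' h1.symm h2.symm h3
  | succ d ih =>
    intro b b' h1 h2 h3
    obtain ⟨b'', hr, hc, hv⟩ := T.isColStrict.exists_right h1 h2 (by omega)
    exact (hadj b b'' hv hr hc).trans (ih b'' b' (hv.trans h1) (hr.trans h2) (by omega))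

/-- The tableau described by a straight permutation. -/
noncomputable def ofStraight (π : Equiv.Perm ℕ)
    (hπ : Straight t (fun i => node T.val (T.box i)) π) : APSYTOver T where
  val :=
    { label := fun b => ⟨π (T.box.symm b) + 1, T.val b⟩
      idx_pos := fun b => by simp
      strict := by
        refine ⟨fun b b' hr hc => ?_, fun b b' hc hr => Or.inl (T.col_strict b b' hc hr)⟩
        rcases (T.row_weak b b' hr hc).lt_or_eq with h | h
        · exact Or.inl h
        · refine Or.inr ⟨h.symm, Nat.succ_lt_succ ?_⟩
          exact hπ.lt_of_same_row (b'.1.2 - b.1.2 - 1) b b' h.symm hr (by omega)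
      finite_exp := T.finite_support.subset fun b hb => Nat.pos_iff_ne_zero.mp hb
      existsUnique_idx := by
        intro i hi
        refine ⟨T.box (π.symm (i - 1)), by simp; omega, fun b hb => ?_⟩
        simp only at hb
        rw [← Equiv.symm_apply_eq, Equiv.eq_symm_apply]
        omega }
  property := rfl

/-- Tableaux over `T` correspond to straight permutations. -/
noncomputable def straightEquiv :
    APSYTOver T ≃ {π // Straight t (fun i => node T.val (T.box i)) π} :=
  Equiv.ofBijective (fun τ => ⟨τ.perm, τ.straight_perm⟩)
    ⟨fun τ τ' h => APSYTOver.perm_injective T (congrArg Subtype.val h), fun π =>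
      ⟨ofStraight T π.1 π.2, Subtype.ext (Equiv.ext fun i => by
        have := (ofStraight T π.1 π.2).idx_eq i
        simp only [ofStraight, Equiv.symm_apply_apply] at this ⊢
        omega)⟩⟩

theorem node_box_tail (k : ℕ) :
    node T.val (T.box (T.rk + k)) = t ^ k * node T.val (T.box T.rk) := by
  obtain ⟨hn, hvan⟩ := T.rk_spec
  have h0 : ∀ k, T.val (T.box (T.rk + k)) = 0 := fun k => hvan _ fun h => by
    rw [T.box_mem_pad_iff] at h
    omega
  have h1 := h0 0
  have h2 := T.box_tail 0
  simp only [add_zero] at h1 h2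
  rw [node, node, T.box_tail, h0, h1, h2, ← zpow_natCast, mul_left_comm, ← zpow_add₀ t_ne_zero]
  congr 2
  unfold content
  push_cast
  ring

theorem APSYTOver.mem_Inv_iff {T : Omega lam} (τ : APSYTOver T) (i j : ℕ) :
    (T.box i, T.box j) ∈ Inv τ.1.label ↔ (i, j) ∈ invSet τ.perm := by
  have hexp : expo τ.1.label = T.val := τ.2
  change _ ∧ _ ↔ _ ∧ _
  rw [hexp, stdLabel_lt_iff T.finite_precedes, T.precedes_box_iff, τ.idx_eq, τ.idx_eq]
  exact and_congr Iff.rfl (by simp)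

theorem APSYTOver.bijOn_Inv {T : Omega lam} (τ : APSYTOver T) :
    Set.BijOn (T.box.prodCongr T.box) (invSet τ.perm) (Inv τ.1.label) := by
  refine ⟨fun p hp => (τ.mem_Inv_iff p.1 p.2).mpr hp, (Equiv.injective _).injOn, ?_⟩
  rintro ⟨b, b'⟩ h
  obtain ⟨i, rfl⟩ := T.box.surjective b
  obtain ⟨j, rfl⟩ := T.box.surjective b'
  exact ⟨(i, j), (τ.mem_Inv_iff i j).mp h, rfl⟩

theorem APSYTOver.finite_invSet {T : Omega lam} (τ : APSYTOver T) : (invSet τ.perm).Finite :=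
  VVMac.finite_invSet (τ.straight_perm.lt_of_tail (n := T.rk) (node_box_tail T))

theorem APSYTOver.finite_Inv {T : Omega lam} (τ : APSYTOver T) : (Inv τ.1.label).Finite := by
  rw [← τ.bijOn_Inv.image_eq]
  exact τ.finite_invSet.image _

/-- Finiteness of the inversion set rules out the default values of `ncard` and `finprod`; the power
of t is then spread as one factor t per inversion. -/
theorem seriesTerm_eq (τ : APSYTOver T) :
    seriesTerm T τ = ∏ᶠ p ∈ invSet τ.perm,
      invWeight t (node T.val (T.box p.1)) (node T.val (T.box p.2)) := by
  have hcard : (Inv τ.1.label).ncard = #τ.finite_invSet.toFinset := by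
    rw [← τ.bijOn_Inv.image_eq, Set.ncard_image_of_injective _ (Equiv.injective _),
      Set.ncard_eq_toFinset_card _ τ.finite_invSet]
  rw [seriesTerm, hcard, ← finprod_mem_eq_of_bijOn _ τ.bijOn_Inv (fun p _ => rfl),
    finprod_mem_eq_finite_toFinset_prod _ τ.finite_invSet,
    finprod_mem_eq_finite_toFinset_prod _ τ.finite_invSet, ← prod_const, ← prod_mul_distrib]
  refine prod_congr rfl fun p _ => ?_
  rw [pairFactor_eq, pairFactor_eq, invWeight, zpow_neg_one, zpow_one]
  rfl

/-- In a bad pair the content does not increase. If T vanished at the first box it would vanish at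
the second, and the content would increase; so the first box is in the finite support, and the
second has bounded content. -/
theorem finite_bad_pairs : {p : ℕ × ℕ | p.1 < p.2 ∧
    ¬ Valued.v (invWeight t (node T.val (T.box p.1)) (node T.val (T.box p.2))) ≤
      Valued.v t}.Finite := by
  have hfin : (⋃ b ∈ {b | T.val b ≠ 0}, (Prod.mk b) ''
      {b' : padInf lam | content b'.1 ≤ content b.1}).Finite :=
    T.finite_support.biUnion fun b _ => (finite_content_le _).image _
  refine (hfin.preimage (f := T.box.prodCongr T.box) (Equiv.injective _).injOn).subset ?_
  rintro ⟨i, j⟩ ⟨hij, hv⟩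
  simp only [Set.mem_preimage, Set.mem_iUnion]
  have hle : content (T.box j).1 ≤ content (T.box i).1 := by
    by_contra hc
    exact hv (valuation_invWeight_le (not_le.mp hc))
  refine ⟨T.box i, fun h0 => ?_, T.box j, hle, rfl⟩
  have hp : Precedes T.val (T.box i) (T.box j) := T.precedes_box_iff.mpr hij
  have heq : T.val (T.box i) = T.val (T.box j) := by
    unfold Precedes at hp
    omega
  have := T.isColStrict.content_lt heq ((T.isColStrict.precedes_iff_col_lt heq).mp hp)
  omega

/-- The series side, as a product over the boxes of `λ^{(rk T)}`. -/
theorem hasSum_seriesTerm :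
    HasSum (seriesTerm T)
      ((∏ i ∈ range T.rk, (1 - node T.val (T.box T.rk) / node T.val (T.box i))) /
        (1 - t) ^ T.rk * ∏ j ∈ range T.rk, ∏ i ∈ range j,
          pairRatio t (node T.val (T.box i)) (node T.val (T.box j))) := by
  have h := hasSum_straight t (fun i => node T.val (T.box i)) T.rk (fun i => node_ne_zero _)
    ((node_injective T.isColStrict).comp T.box.injective)
    (fun i j hij => node_ne_t_mul T.isColStrict (T.precedes_box_iff.mpr hij)) (node_box_tail T)
    tendsto_t_pow valuation_t_lt_one.le (finite_bad_pairs T)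
  rw [← (straightEquiv T).hasSum_iff] at h
  have hfun : seriesTerm T = (fun π : {π // Straight t (fun i => node T.val (T.box i)) π} =>
      ∏ᶠ p ∈ invSet π.1, invWeight t (node T.val (T.box p.1)) (node T.val (T.box p.2))) ∘
        straightEquiv T := funext fun τ => seriesTerm_eq T τ
  rw [hfun]
  exact h

end Series

end VVMac

namespace VVMac

open Finset

/-! ### Existence and uniqueness of Min(T) -/

section MinTableau

variable {μ : YoungDiagram} {T : boxes μ → ℕ}

/-- The order of the boxes by increasing `T`, then by rows from top to bottom, and from left to
right within a row. -/
def RowBefore (T : boxes μ → ℕ) (b b' : boxes μ) : Prop :=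
  T b < T b' ∨ (T b = T b' ∧ (b.1.1 < b'.1.1 ∨ (b.1.1 = b'.1.1 ∧ b.1.2 < b'.1.2)))

instance (T : boxes μ → ℕ) : DecidableRel (RowBefore T) := fun _ _ => by
  unfold RowBefore
  infer_instance

theorem rowBefore_irrefl (b : boxes μ) : ¬ RowBefore T b b := by
  unfold RowBefore
  omega

theorem RowBefore.trans {a b c : boxes μ} (h1 : RowBefore T a b) (h2 : RowBefore T b c) :
    RowBefore T a c := by
  unfold RowBefore at *
  omega

theorem rowBefore_trichotomy (b b' : boxes μ) :
    RowBefore T b b' ∨ b = b' ∨ RowBefore T b' b := by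
  by_cases h : b.1.2 = b'.1.2 ∧ b.1.1 = b'.1.1
  · exact Or.inr (Or.inl (Subtype.ext (Prod.ext h.2 h.1)))
  · unfold RowBefore
    omega

/-- The number of boxes before `b` in the order `RowBefore T`. -/
def rowRank (T : boxes μ → ℕ) (b : boxes μ) : ℕ := #{b' | RowBefore T b' b}

theorem rowRank_lt_of_rowBefore {b b' : boxes μ} (h : RowBefore T b b') :
    rowRank T b < rowRank T b' := by
  refine card_lt_card ⟨fun a ha => ?_, fun hs => ?_⟩
  · rw [mem_filter] at ha ⊢
    exact ⟨mem_univ _, ha.2.trans h⟩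
  · exact rowBefore_irrefl b (mem_filter.mp (hs (mem_filter.mpr ⟨mem_univ _, h⟩))).2

theorem rowRank_lt_iff {b b' : boxes μ} : rowRank T b < rowRank T b' ↔ RowBefore T b b' := by
  refine ⟨fun h => ?_, rowRank_lt_of_rowBefore⟩
  rcases rowBefore_trichotomy (T := T) b b' with h' | h' | h'
  · exact h'
  · rw [h'] at h; exact absurd h (lt_irrefl _)
  · exact absurd (rowRank_lt_of_rowBefore h') h.not_gt

theorem rowRank_injective : Function.Injective (rowRank T) := by
  intro b b' h
  rcases rowBefore_trichotomy (T := T) b b' with h' | h' | h'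
  · exact absurd h (rowRank_lt_of_rowBefore h').ne
  · exact h'
  · exact absurd h (rowRank_lt_of_rowBefore h').ne'

theorem card_boxes : #(univ : Finset (boxes μ)) = μ.card := by
  rw [card_univ]
  exact Fintype.card_coe μ.cells

theorem rowRank_lt_card (b : boxes μ) : rowRank T b < μ.card := by
  rw [← card_boxes]
  exact card_lt_card ⟨filter_subset _ _, fun hs =>
    rowBefore_irrefl b (mem_filter.mp (hs (mem_univ b))).2⟩

theorem exists_rowRank_eq (T : boxes μ → ℕ) {k : ℕ} (hk : k < μ.card) :
    ∃ b, rowRank T b = k := by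
  have : univ.image (rowRank T) = range μ.card := by
    refine eq_of_subset_of_card_le ?_ ?_
    · intro l hl
      obtain ⟨b, -, rfl⟩ := mem_image.mp hl
      exact mem_range.mpr (rowRank_lt_card b)
    · rw [card_image_of_injective _ rowRank_injective, card_boxes, card_range]
  obtain ⟨b, -, h⟩ := mem_image.mp (this.symm ▸ mem_range.mpr hk : k ∈ univ.image (rowRank T))
  exact ⟨b, h⟩

/-- The tableau over `T` whose numbers increase in the order `RowBefore T`. -/
def minTableau (hT : IsColStrict T) : PSYT μ where
  label b := ⟨rowRank T b + 1, T b⟩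
  idx_mem b := by
    have := rowRank_lt_card (T := T) b
    simp only [mem_Icc]
    omega
  existsUnique_idx j hj := by
    rw [mem_Icc] at hj
    obtain ⟨b, hb⟩ := exists_rowRank_eq T (show j - 1 < μ.card by omega)
    refine ⟨b, by simp only; omega, fun b' hb' => rowRank_injective (T := T) ?_⟩
    simp only at hb'
    omega
  strict := by
    refine ⟨fun b b' hr hc => ?_, fun b b' hc hr => Or.inl (hT.col_strict b b' hc hr)⟩
    rcases (hT.row_weak b b' hr hc).lt_or_eq with h | h
    · exact Or.inl h
    · exact Or.inr ⟨h.symm, Nat.succ_lt_succ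
        (rowRank_lt_of_rowBefore (Or.inr ⟨h.symm, Or.inr ⟨hr, hc⟩⟩))⟩

theorem PSYT.ext_label {τ τ' : PSYT μ} (h : τ.label = τ'.label) : τ = τ' := by
  cases τ
  cases τ'
  simp only at h
  subst h
  rfl

theorem PSYT.idx_injective (τ : PSYT μ) : Function.Injective fun b => (τ.label b).idx := by
  intro b b' h
  obtain ⟨c, -, hc⟩ := τ.existsUnique_idx _ (τ.idx_mem b)
  exact (hc b rfl).trans (hc b' h.symm).symm

/-- The numbers are recovered from their relative order, so tableaux over T may be compared through
that order alone. -/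
theorem PSYT.idx_eq_card (τ : PSYT μ) (b : boxes μ) :
    (τ.label b).idx = #{b' | (τ.label b').idx ≤ (τ.label b).idx} := by
  have himg : ({b' | (τ.label b').idx ≤ (τ.label b).idx} : Finset (boxes μ)).image
      (fun b => (τ.label b).idx) = Icc 1 (τ.label b).idx := by
    ext k
    simp only [mem_image, mem_filter, mem_univ, true_and, mem_Icc]
    constructor
    · rintro ⟨b', hb', rfl⟩
      exact ⟨(mem_Icc.mp (τ.idx_mem b')).1, hb'⟩
    · rintro ⟨h1, h2⟩
      obtain ⟨b', hb', -⟩ := τ.existsUnique_idx k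
        (mem_Icc.mpr ⟨h1, h2.trans (mem_Icc.mp (τ.idx_mem b)).2⟩)
      exact ⟨b', by rw [hb']; exact h2, hb'⟩
  have := congrArg card himg
  rw [card_image_of_injective _ τ.idx_injective, Nat.card_Icc] at this
  omega

theorem swapLabel_idx {D : Set (ℕ × ℕ)} (i : ℕ) (f : D → PLabel) (b : D) :
    (swapLabel i f b).idx = Equiv.swap i (i + 1) (f b).idx := by
  unfold swapLabel
  rw [Equiv.swap_apply_def]
  split_ifs <;> rfl

theorem swapLabel_exp {D : Set (ℕ × ℕ)} (i : ℕ) (f : D → PLabel) (b : D) :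
    (swapLabel i f b).exp = (f b).exp := by
  unfold swapLabel
  split_ifs <;> rfl

theorem swapLabel_swapLabel {D : Set (ℕ × ℕ)} (i : ℕ) (f : D → PLabel) :
    swapLabel i (swapLabel i f) = f := by
  funext b
  ext
  · rw [swapLabel_idx, swapLabel_idx, Equiv.swap_apply_self]
  · rw [swapLabel_exp, swapLabel_exp]

theorem lt_of_swap_lt_swap {i x y : ℕ} (h : Equiv.swap i (i + 1) x < Equiv.swap i (i + 1) y)
    (hne : ¬ (x = i + 1 ∧ y = i)) : x < y := by
  rw [Equiv.swap_apply_def, Equiv.swap_apply_def] at h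
  split_ifs at h <;> omega

/-- The tableau `s_i(τ)`, for boxes `b`, `b'` numbered `i`, `i + 1` that are in the wrong order. -/
def PSYT.swap (hT : IsColStrict T) (τ : PSYT μ) (hτ : expo τ.label = T) (b b' : boxes μ)
    (hb : (τ.label b').idx = (τ.label b).idx + 1) (hbb : RowBefore T b' b) : PSYT μ where
  label := swapLabel (τ.label b).idx τ.label
  idx_mem c := by
    rw [swapLabel_idx, Equiv.swap_apply_def]
    split_ifs
    · rw [← hb]; exact τ.idx_mem b'
    · exact τ.idx_mem b
    · exact τ.idx_mem c
  existsUnique_idx j hj := by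
    have hj' : Equiv.swap (τ.label b).idx ((τ.label b).idx + 1) j ∈ Icc 1 μ.card := by
      rw [Equiv.swap_apply_def]
      split_ifs
      · rw [← hb]; exact τ.idx_mem b'
      · exact τ.idx_mem b
      · exact hj
    obtain ⟨c, hc, huniq⟩ := τ.existsUnique_idx _ hj'
    refine ⟨c, ?_, fun c' hc' => huniq c' ?_⟩
    · simp only
      rw [swapLabel_idx, hc, Equiv.swap_apply_self]
    · simp only at hc'
      rw [swapLabel_idx] at hc'
      rw [← hc', Equiv.swap_apply_self]
  strict := by
    have hexp : ∀ c, (τ.label c).exp = T c := fun c => congrFun hτ c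
    refine ⟨fun c c' hr hc => ?_, fun c c' hc hr => Or.inl ?_⟩
    · rcases (hT.row_weak c c' hr hc).lt_or_eq with h | h
      · left
        rw [swapLabel_exp, swapLabel_exp, hexp, hexp]
        exact h
      · right
        rw [swapLabel_exp, swapLabel_exp, hexp, hexp, swapLabel_idx, swapLabel_idx]
        refine ⟨h.symm, ?_⟩
        have hlt : (τ.label c).idx < (τ.label c').idx := by
          rcases τ.strict.1 c c' hr hc with h' | h'
          · rw [hexp, hexp] at h'
            omega
          · exact h'.2
        rw [← Equiv.swap_apply_self (τ.label b).idx ((τ.label b).idx + 1) (τ.label c).idx,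
          ← Equiv.swap_apply_self (τ.label b).idx ((τ.label b).idx + 1) (τ.label c').idx] at hlt
        -- Only the pair b, b' changes its relative order, and it cannot stand in this row with b
        -- left of b' and equal T.
        refine lt_of_swap_lt_swap hlt ?_
        rintro ⟨h1, h2⟩
        rw [Equiv.swap_apply_eq_iff, Equiv.swap_apply_right] at h1
        rw [Equiv.swap_apply_eq_iff, Equiv.swap_apply_left, ← hb] at h2
        have h1 := τ.idx_injective h1
        have h2 := τ.idx_injective h2
        subst h1 h2
        unfold RowBefore at hbb
        omega
    · rw [swapLabel_exp, swapLabel_exp, hexp, hexp]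
      exact hT.col_strict c c' hc hr

/-- If T differs, this is the exponent relation. If T ties and the rows differ, b' is higher and so,
by the strip property, to the right with content gap above 1. A common row would contradict
strictness of τ. -/
theorem PSYT.cover_swap (hT : IsColStrict T) (τ : PSYT μ) (hτ : expo τ.label = T) (b b' : boxes μ)
    (hb : (τ.label b').idx = (τ.label b).idx + 1) (hbb : RowBefore T b' b) :
    Cover (τ.swap hT hτ b b' hb hbb) τ := by
  have hexp : ∀ c, (τ.label c).exp = T c := fun c => congrFun hτ c
  have h1 : ((τ.swap hT hτ b b' hb hbb).label b').idx = (τ.label b).idx := by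
    change (swapLabel _ _ _).idx = _
    rw [swapLabel_idx, hb, Equiv.swap_apply_right]
  have h2 : ((τ.swap hT hτ b b' hb hbb).label b).idx = (τ.label b).idx + 1 := by
    change (swapLabel _ _ _).idx = _
    rw [swapLabel_idx, Equiv.swap_apply_left]
  have h3 : ∀ c, ((τ.swap hT hτ b b' hb hbb).label c).exp = T c := fun c => by
    change (swapLabel _ _ _).exp = _
    rw [swapLabel_exp, hexp]
  have h4 : τ.label = swapLabel (τ.label b).idx (τ.swap hT hτ b b' hb hbb).label :=
    (swapLabel_swapLabel _ _).symm
  rcases hbb with h | ⟨h, h'⟩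
  · exact Cover.swap_exp _ _ _ b' b h1 h2 (by rw [h3, h3]; exact h) h4
  · refine Cover.swap_content _ _ _ b' b h1 h2 (by rw [h3, h3]; exact h) ?_ h4
    rcases h' with hr | ⟨hr, hc⟩
    · have hcol : b.1.2 < b'.1.2 := by
        rcases lt_trichotomy b.1.2 b'.1.2 with hc | hc | hc
        · exact hc
        · rw [hT.eq_of_col_eq h.symm hc] at hr
          exact absurd hr (lt_irrefl _)
        · have := hT.row_le h hc
          omega
      have := hT.content_add_one_lt h.symm hcol hr.ne'
      omega
    · have hlt := τ.strict.1 b' b hr hc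
      rcases hlt with hlt | hlt
      · rw [hexp, hexp] at hlt
        omega
      · omega

/-- Without an adjacent descent, transitivity makes the whole numbering follow `RowBefore T`, which
determines the tableau. -/
theorem exists_adjacent_of_ne (hT : IsColStrict T) (τ : PSYT μ) (hτ : expo τ.label = T)
    (hne : minTableau hT ≠ τ) :
    ∃ b b' : boxes μ, (τ.label b').idx = (τ.label b).idx + 1 ∧ RowBefore T b' b := by
  by_contra hc
  push Not at hc
  have hmono : ∀ d, ∀ b b' : boxes μ, (τ.label b').idx = (τ.label b).idx + d + 1 →
      RowBefore T b b' := by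
    have hadj : ∀ b b' : boxes μ, (τ.label b').idx = (τ.label b).idx + 1 → RowBefore T b b' := by
      intro b b' h
      rcases rowBefore_trichotomy (T := T) b b' with h' | h' | h'
      · exact h'
      · rw [h'] at h; omega
      · exact absurd h' (hc b b' h)
    intro d
    induction d with
    | zero => exact hadj
    | succ d ih =>
      intro b b' h
      have h1 := mem_Icc.mp (τ.idx_mem b)
      have h2 := mem_Icc.mp (τ.idx_mem b')
      obtain ⟨c, hc', -⟩ := τ.existsUnique_idx ((τ.label b).idx + 1) (mem_Icc.mpr (by omega))
      exact (hadj b c hc').trans (ih c b' (by omega))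
  have hlt : ∀ b b' : boxes μ, (τ.label b).idx < (τ.label b').idx ↔ RowBefore T b b' := by
    intro b b'
    constructor
    · intro h
      exact hmono ((τ.label b').idx - (τ.label b).idx - 1) b b' (by omega)
    · intro h
      by_contra hn
      rcases (not_lt.mp hn).eq_or_lt with h' | h'
      · rw [τ.idx_injective h'] at h
        exact rowBefore_irrefl _ h
      · exact rowBefore_irrefl _ (h.trans
          (hmono ((τ.label b).idx - (τ.label b').idx - 1) b' b (by omega)))
  refine hne (PSYT.ext_label (funext fun b => ?_))
  ext
  · rw [PSYT.idx_eq_card (minTableau hT) b, PSYT.idx_eq_card τ b]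
    refine congrArg card (filter_congr fun b' _ => ?_)
    rw [← not_lt, ← not_lt, hlt]
    change ¬ (rowRank T b + 1 < rowRank T b' + 1) ↔ _
    rw [Nat.succ_lt_succ_iff, rowRank_lt_iff]
  · exact (congrFun hτ b).symm

/-- Bubble sort: a swap at an adjacent descent removes that descent from the set of inversions
relative to `RowBefore T` and creates none. -/
theorem minTableau_le (hT : IsColStrict T) (τ : PSYT μ) (hτ : expo τ.label = T) :
    minTableau hT ≤ τ := by
  induction hk : #{p : boxes μ × boxes μ | (τ.label p.1).idx < (τ.label p.2).idx ∧
      RowBefore T p.2 p.1} using Nat.strong_induction_on generalizing τ with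
  | _ k ih =>
    by_cases hne : minTableau hT = τ
    · rw [hne]
      exact Relation.ReflTransGen.refl
    · obtain ⟨b, b', hb, hbb⟩ := exists_adjacent_of_ne hT τ hτ hne
      have hle : minTableau hT ≤ τ.swap hT hτ b b' hb hbb := by
        refine ih _ ?_ _ ?_ rfl
        · rw [← hk]
          refine card_lt_card ⟨fun p hp => ?_, fun hs => ?_⟩
          · simp only [mem_filter, mem_univ, true_and] at hp ⊢
            refine ⟨?_, hp.2⟩
            have h1 : (swapLabel (τ.label b).idx τ.label p.1).idx <
              (swapLabel (τ.label b).idx τ.label p.2).idx := hp.1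
            rw [swapLabel_idx, swapLabel_idx] at h1
            refine lt_of_swap_lt_swap h1 ?_
            rintro ⟨h2, h3⟩
            rw [← hb] at h2
            have h2 := τ.idx_injective h2
            have h3 := τ.idx_injective h3
            rw [h2, h3] at hp
            exact rowBefore_irrefl _ (hp.2.trans hbb)
          · have hmem := hs (x := (b, b')) (by
              simp only [mem_filter, mem_univ, true_and]
              exact ⟨by omega, hbb⟩)
            simp only [mem_filter, mem_univ, true_and] at hmem
            have h1 : (swapLabel (τ.label b).idx τ.label b).idx <
              (swapLabel (τ.label b).idx τ.label b').idx := hmem.1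
            rw [swapLabel_idx, swapLabel_idx, hb, Equiv.swap_apply_left,
              Equiv.swap_apply_right] at h1
            omega
        · funext c
          change (swapLabel _ _ _).exp = _
          rw [swapLabel_exp]
          exact congrFun hτ c
      exact Relation.ReflTransGen.tail hle (τ.cover_swap hT hτ b b' hb hbb)

theorem isMinTableau_minTableau (hT : IsColStrict T) : IsMinTableau T (minTableau hT) :=
  ⟨rfl, minTableau_le hT⟩

theorem Cover.exp_le {τ τ' : PSYT μ} (h : Cover τ τ') (b : boxes μ) :
    (τ.label b).exp ≤ (τ'.label b).exp := by
  rcases h with h | ⟨i, _, _, _, _, _, h⟩ | ⟨i, _, _, _, _, _, _, h⟩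
  · rw [h]
    unfold psiLabel
    split_ifs <;> simp
  · rw [h, swapLabel_exp]
  · rw [h, swapLabel_exp]

theorem exp_le_of_le {τ τ' : PSYT μ} (h : τ ≤ τ') (b : boxes μ) :
    (τ.label b).exp ≤ (τ'.label b).exp := by
  replace h : Relation.ReflTransGen Cover τ τ' := h
  induction h with
  | refl => exact le_rfl
  | tail _ h ih => exact ih.trans (h.exp_le b)

/-- No antisymmetry is needed: a chain from M to `minTableau` cannot have a last step. Exponents
never decrease along the chain, so its last predecessor also lies over T. This excludes Ψ, and a
swap would arrive at an order opposite to `RowBefore T`. -/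
theorem IsMinTableau.eq_minTableau (hT : IsColStrict T) {M : PSYT μ} (hM : IsMinTableau T M) :
    M = minTableau hT := by
  obtain ⟨hexp, hle⟩ := hM
  have hMexp : ∀ b, (M.label b).exp = T b := fun b => congrFun hexp b
  rcases Relation.ReflTransGen.cases_tail (hle (minTableau hT) rfl) with h | ⟨τ, hMτ, hcov⟩
  · exact h.symm
  have hτ : ∀ b, (τ.label b).exp = T b := fun b =>
    le_antisymm (hcov.exp_le b) ((hMexp b).ge.trans (exp_le_of_le hMτ b))
  have hidx : ∀ {i : ℕ} {b₁ b₂ : boxes μ}, (τ.label b₁).idx = i → (τ.label b₂).idx = i + 1 →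
      (minTableau hT).label = swapLabel i τ.label → RowBefore T b₂ b₁ := by
    intro i b₁ b₂ h₁ h₂ h
    have e₁ : rowRank T b₁ + 1 = i + 1 := by
      have : ((minTableau hT).label b₁).idx = i + 1 := by
        rw [h, swapLabel_idx, h₁, Equiv.swap_apply_left]
      exact this
    have e₂ : rowRank T b₂ + 1 = i := by
      have : ((minTableau hT).label b₂).idx = i := by
        rw [h, swapLabel_idx, h₂, Equiv.swap_apply_right]
      exact this
    rw [← rowRank_lt_iff]
    omega
  rcases hcov with h | ⟨i, b₁, b₂, h₁, h₂, hw, h⟩ | ⟨i, b₁, b₂, h₁, h₂, hw, hc, h⟩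
  · rcases Nat.eq_zero_or_pos μ.card with h0 | h0
    · refine PSYT.ext_label (funext fun b => ?_)
      have := mem_Icc.mp (M.idx_mem b)
      omega
    · obtain ⟨b, hb, -⟩ := τ.existsUnique_idx 1 (mem_Icc.mpr ⟨le_rfl, h0⟩)
      have h1 : ((minTableau hT).label b).exp = (τ.label b).exp + 1 := by
        rw [h]
        unfold psiLabel
        rw [if_neg (by omega)]
      rw [hτ] at h1
      have h2 : ((minTableau hT).label b).exp = T b := rfl
      omega
  · have := hidx h₁ h₂ h
    rw [hτ, hτ] at hw
    unfold RowBefore at this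
    omega
  · have hbb := hidx h₁ h₂ h
    rw [hτ, hτ] at hw
    exfalso
    rcases hbb with hbb | ⟨-, hr | ⟨hr, hcol⟩⟩
    · omega
    · rcases lt_trichotomy b₁.1.2 b₂.1.2 with hcol | hcol | hcol
      · have := hT.content_lt hw hcol
        omega
      · rw [hT.eq_of_col_eq hw hcol] at hr
        exact lt_irrefl _ hr
      · have := hT.row_le hw.symm hcol
        omega
    · rcases τ.strict.1 b₂ b₁ hr hcol with h' | h'
      · rw [hτ, hτ] at h'
        omega
      · omega

end MinTableau

end VVMac

namespace VVMac

open Finset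

/-! ### Pairs of boxes in Min(T) and the composition μ_T -/

section ProductSide

variable {μ : YoungDiagram} {T : boxes μ → ℕ}

/-- The box that carries the number `i + 1` in the minimal tableau. -/
noncomputable def minBox (T : boxes μ → ℕ) : Fin μ.card ≃ boxes μ :=
  (Equiv.ofBijective (fun b => (⟨rowRank T b, rowRank_lt_card b⟩ : Fin μ.card))
    ⟨fun b b' h => rowRank_injective (T := T) (by simpa using h), fun k =>
      (exists_rowRank_eq T k.is_lt).imp fun b h => Fin.ext h⟩).symm

theorem rowRank_minBox (i : Fin μ.card) : rowRank T (minBox T i) = i :=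
  congrArg Fin.val ((minBox T).symm_apply_apply i)

theorem rowBefore_minBox_iff {i j : Fin μ.card} :
    RowBefore T (minBox T i) (minBox T j) ↔ i < j := by
  rw [← rowRank_lt_iff, rowRank_minBox, rowRank_minBox, Fin.lt_def]

/-- Positions count from 0 and numbers from 1: the numbers j and j + 1 sit in `minBox T i` and
`minBox T j`. -/
theorem joined_minTableau_iff (hT : IsColStrict T) {i j : Fin μ.card} (hij : (j : ℕ) = i + 1) :
    Joined (minTableau hT) j ↔ (minBox T i).1.1 = (minBox T j).1.1 ∧
      T (minBox T i) = T (minBox T j) := by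
  constructor
  · rintro ⟨b, b', h1, h2, h3, h4⟩
    have e1 : rowRank T b + 1 = j := h1
    have e2 : rowRank T b' + 1 = j + 1 := h2
    have h1 : b = minBox T i := rowRank_injective (T := T) (by rw [rowRank_minBox]; omega)
    have h2 : b' = minBox T j := rowRank_injective (T := T) (by rw [rowRank_minBox]; omega)
    subst h1 h2
    exact ⟨h3, h4⟩
  · rintro ⟨h1, h2⟩
    refine ⟨minBox T i, minBox T j, ?_, ?_, h1, h2⟩
    · change rowRank T _ + 1 = _
      rw [rowRank_minBox, hij]
    · change rowRank T _ + 1 = _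
      rw [rowRank_minBox]

/-- The right neighbour of the first box has the same T; were it not the second box, its number
would fall strictly between two consecutive ones. -/
theorem content_minBox_succ (hT : IsColStrict T) {i j : Fin μ.card} (hij : (j : ℕ) = i + 1)
    (hr : (minBox T i).1.1 = (minBox T j).1.1) (hv : T (minBox T i) = T (minBox T j)) :
    content (minBox T j).1 = content (minBox T i).1 + 1 := by
  have hlt : RowBefore T (minBox T i) (minBox T j) :=
    rowBefore_minBox_iff.mpr (by rw [Fin.lt_def]; omega)
  have hcol : (minBox T i).1.2 < (minBox T j).1.2 := by
    unfold RowBefore at hlt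
    omega
  obtain ⟨b, h1, h2, h3⟩ := hT.exists_right hv hr hcol
  obtain ⟨k, rfl⟩ := (minBox T).surjective b
  have hik : i < k := rowBefore_minBox_iff.mp (Or.inr ⟨h3.symm, Or.inr ⟨h1.symm, by omega⟩⟩)
  have hkj : k = j := by
    by_contra hne
    have hjk : j < k := by
      rw [Fin.lt_def] at hik ⊢
      have : (k : ℕ) ≠ j := fun h => hne (Fin.ext h)
      omega
    have := rowBefore_minBox_iff (T := T) |>.mpr hjk
    unfold RowBefore at this
    omega
  subst hkj
  unfold content
  omega

theorem mem_boundaries_muComp (M : PSYT μ) (b : Fin (μ.card + 1)) :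
    b ∈ (muComp M).boundaries ↔ b = 0 ∨ b = Fin.last μ.card ∨ ¬ Joined M b := by
  rw [muComp, CompositionAsSet.toComposition_boundaries]
  simp

theorem index_muComp_eq_iff_joined (M : PSYT μ) {i j : Fin μ.card} (hij : i ≤ j) :
    (muComp M).index i = (muComp M).index j ↔
      ∀ b : ℕ, (i : ℕ) < b → b ≤ j → Joined M b := by
  rw [index_eq_iff_forall_notMem_boundaries _ hij]
  constructor
  · intro h b h1 h2
    have := h ⟨b, by omega⟩ h1 h2
    rw [mem_boundaries_muComp] at this
    push Not at this
    exact this.2.2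
  · intro h b h1 h2 hb
    rw [mem_boundaries_muComp] at hb
    rcases hb with hb | hb | hb
    · rw [hb] at h1
      simp at h1
    · rw [hb] at h2
      simp only [Fin.val_last] at h2
      omega
    · exact hb (h b h1 h2)

/-- Contents rise by 1 at each step inside a block, so the content difference of two boxes is their
offset, as `prod_same_block` requires. -/
theorem content_minBox_of_index_eq (hT : IsColStrict T) (d : ℕ) :
    ∀ i j : Fin μ.card, (j : ℕ) = i + d →
      (muComp (minTableau hT)).index i = (muComp (minTableau hT)).index j →
      (minBox T i).1.1 = (minBox T j).1.1 ∧ T (minBox T i) = T (minBox T j) ∧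
        content (minBox T j).1 = content (minBox T i).1 + d := by
  induction d with
  | zero =>
    intro i j hij _
    have : j = i := Fin.ext (by omega)
    subst this
    simp
  | succ d ih =>
    intro i j hij hidx
    have hle : i ≤ j := by rw [Fin.le_def]; omega
    rw [index_muComp_eq_iff_joined _ hle] at hidx
    set k : Fin μ.card := ⟨i + d, by omega⟩ with hk
    have hik : i ≤ k := by rw [Fin.le_def]; simp [hk]
    obtain ⟨h1, h2, h3⟩ := ih i k rfl ((index_muComp_eq_iff_joined _ hik).mpr
      fun b hb hb' => hidx b hb (by simp only [hk] at hb'; omega))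
    have hkj : (j : ℕ) = k + 1 := by simp only [hk]; omega
    obtain ⟨h4, h5⟩ := (joined_minTableau_iff hT hkj).mp (hidx j (by omega) le_rfl)
    have h6 := content_minBox_succ hT hkj h4 h5
    refine ⟨h1.trans h4, h2.trans h5, ?_⟩
    push_cast
    omega

/-- The boxes of one row with one value of T form an interval of `RowBefore T`, so all consecutive
numbers between the two are joined. -/
theorem index_muComp_eq_iff (hT : IsColStrict T) {i j : Fin μ.card} (hij : i < j) :
    (muComp (minTableau hT)).index i = (muComp (minTableau hT)).index j ↔
      (minBox T i).1.1 = (minBox T j).1.1 ∧ T (minBox T i) = T (minBox T j) := by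
  constructor
  · intro h
    have hij : (i : ℕ) < j := hij
    obtain ⟨h1, h2, -⟩ := content_minBox_of_index_eq hT ((j : ℕ) - i) i j (by omega) h
    exact ⟨h1, h2⟩
  · rintro ⟨h1, h2⟩
    rw [index_muComp_eq_iff_joined _ hij.le]
    intro b hib hbj
    set l : Fin μ.card := ⟨b, by omega⟩ with hl
    set k : Fin μ.card := ⟨b - 1, by omega⟩ with hk
    have hmid : ∀ m : Fin μ.card, i ≤ m → m ≤ j →
        (minBox T m).1.1 = (minBox T i).1.1 ∧ T (minBox T m) = T (minBox T i) := by
      intro m him hmj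
      rcases him.eq_or_lt with rfl | him
      · exact ⟨rfl, rfl⟩
      rcases hmj.eq_or_lt with rfl | hmj
      · exact ⟨h1.symm, h2.symm⟩
      have e1 := rowBefore_minBox_iff (T := T) |>.mpr him
      have e2 := rowBefore_minBox_iff (T := T) |>.mpr hmj
      unfold RowBefore at e1 e2
      omega
    have hL := hmid l (by rw [Fin.le_def]; simp only [hl]; omega)
      (by rw [Fin.le_def]; simp only [hl]; omega)
    have hK := hmid k (by rw [Fin.le_def]; simp only [hk]; omega)
      (by rw [Fin.le_def]; simp only [hk]; omega)
    have hkl : (l : ℕ) = k + 1 := by simp only [hl, hk]; omega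
    exact (joined_minTableau_iff hT hkl).mpr
      ⟨hK.1.trans hL.1.symm, hK.2.trans hL.2.symm⟩

theorem precedes_of_same_row {b b' : boxes μ} (hr : b.1.1 = b'.1.1) (hv : T b = T b')
    (h : RowBefore T b b') : Precedes T b b' := by
  unfold RowBefore at h
  exact Or.inr ⟨hv, Or.inl (by omega)⟩

/-- The two orders treat T oppositely, so both can hold only at a tie. There columns go right while
rows go weakly up, which agrees with row order only inside a row. -/
theorem same_row_of_precedes_of_rowBefore (hT : IsColStrict T) {b b' : boxes μ}
    (hp : Precedes T b b') (h : RowBefore T b b') : b.1.1 = b'.1.1 ∧ T b = T b' := by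
  have hv : T b = T b' := by
    unfold Precedes at hp
    unfold RowBefore at h
    omega
  have := hT.row_le hv ((hT.precedes_iff_col_lt hv).mp hp)
  unfold RowBefore at h
  exact ⟨by omega, hv⟩

open Classical in
/-- The pairs of boxes that are not inverted in the minimal tableau contribute `1 / [μ(T)]_t!`. -/
theorem prod_not_inverted (hT : IsColStrict T) :
    ∏ b : boxes μ, ∏ b' : boxes μ, (if Precedes T b b' ∧ RowBefore T b b' then
      pairRatio t (node T b) (node T b') else 1) =
      (tFactorialComp (muComp (minTableau hT)))⁻¹ := by
  rw [tFactorialComp, show tFactorial = fun m => ∏ i ∈ Icc 1 m, (1 - t ^ i) / (1 - t) from rfl,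
    ← prod_same_block _ t t_pow_succ_ne_one, Finset.prod_comm, ← (minBox T).prod_comp]
  refine prod_congr rfl fun j _ => ?_
  rw [← (minBox T).prod_comp]
  refine prod_congr rfl fun i _ => ?_
  simp only [rowBefore_minBox_iff]
  by_cases hij : i < j
  · have hiff : Precedes T (minBox T i) (minBox T j) ↔
        (muComp (minTableau hT)).index i = (muComp (minTableau hT)).index j := by
      rw [index_muComp_eq_iff hT hij]
      exact ⟨fun h => same_row_of_precedes_of_rowBefore hT h (rowBefore_minBox_iff.mpr hij),
        fun h => precedes_of_same_row h.1 h.2 (rowBefore_minBox_iff.mpr hij)⟩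
    simp only [hij, and_true, true_and, hiff]
    split_ifs with hidx
    · have hlt : (i : ℕ) < j := hij
      obtain ⟨-, hv, hc⟩ := content_minBox_of_index_eq hT ((j : ℕ) - i) i j (by omega) hidx
      rw [pairRatio, node_div_node, hv, hc, sub_self, zpow_zero, one_mul, add_sub_cancel_left,
        zpow_natCast, pow_succ]
    · rfl
  · simp [hij]

open Classical in
-- Each pair in `Precedes` order is split by its `RowBefore` direction: the reversed pairs are the
-- inversions of the minimal tableau, the rest is `prod_not_inverted`.
theorem prod_precedes_eq (hT : IsColStrict T) :
    ∏ b : boxes μ, ∏ b' : boxes μ, (if Precedes T b b' then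
      pairRatio t (node T b) (node T b') else 1) =
      (tFactorialComp (muComp (minTableau hT)))⁻¹ *
        ∏ᶠ p ∈ Inv (minTableau hT).label, pairFactor T p 0 / pairFactor T p 1 := by
  have hset : Inv (minTableau hT).label =
      ((univ.filter fun p : boxes μ × boxes μ => Precedes T p.1 p.2 ∧ RowBefore T p.2 p.1 :
        Finset (boxes μ × boxes μ)) : Set (boxes μ × boxes μ)) := by
    ext p
    rw [mem_coe, mem_filter]
    change stdLabel T p.1 < stdLabel T p.2 ∧ rowRank T p.2 + 1 < rowRank T p.1 + 1 ↔ _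
    rw [stdLabel_lt_iff (fun b => Set.toFinite _), Nat.succ_lt_succ_iff, rowRank_lt_iff]
    simp
  rw [hset, finprod_mem_coe_finset, prod_filter, ← univ_product_univ, prod_product,
    ← prod_not_inverted hT, ← prod_mul_distrib]
  refine prod_congr rfl fun b _ => ?_
  rw [← prod_mul_distrib]
  refine prod_congr rfl fun b' _ => ?_
  by_cases hp : Precedes T b b'
  · have hfac : pairFactor T (b, b') 0 / pairFactor T (b, b') 1 =
        pairRatio t (node T b) (node T b') := by
      rw [pairFactor_eq, pairFactor_eq, pairRatio, zpow_zero, zpow_one, mul_one]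
    rw [hfac]
    rcases rowBefore_trichotomy (T := T) b b' with h | h | h
    · have h' : ¬ RowBefore T b' b := fun h' => rowBefore_irrefl _ (h.trans h')
      simp [hp, h, h']
    · rw [h] at hp
      exact absurd hp (precedes_irrefl _)
    · have h' : ¬ RowBefore T b b' := fun h' => rowBefore_irrefl _ (h.trans h')
      simp [hp, h, h']
  · simp [hp]

end ProductSide

/-! ### Matching the two sides -/

section Assembly

variable {lam : YoungDiagram} (T : Omega lam)

/-- The boxes of `λ^{(rk T)}` are the first `rk T` boxes in the standard order. -/
noncomputable def headBox : Fin T.rk ≃ boxes (pad lam T.rk) where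
  toFun i := ⟨(T.box i).1, (T.box_mem_pad_iff i).mpr i.is_lt⟩
  invFun b := ⟨T.box.symm ⟨b.1, pad_subset_padInf lam _ b.2⟩, by
    rw [← T.box_mem_pad_iff, Equiv.apply_symm_apply]
    exact b.2⟩
  left_inv i := by simp
  right_inv b := by simp

theorem precedes_headBox_iff {i j : Fin T.rk} :
    Precedes (T.restrict T.rk) (headBox T i) (headBox T j) ↔ i < j :=
  T.precedes_box_iff (i := i) (j := j)

/-- The first box beyond λ^(rk T) is (0, rk T - |λ|), where T = 0, so its node is t^(rk T - |λ|). -/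
theorem prod_tail_factor :
    ∏ i ∈ range T.rk, (1 - node T.val (T.box T.rk) / node T.val (T.box i)) =
      ∏ b : boxes (pad lam T.rk), (1 - q ^ (-(T.restrict T.rk b : ℤ)) *
        t ^ ((T.rk : ℤ) - (lam.card : ℤ) - content b.1)) := by
  obtain ⟨hn, hvan⟩ := T.rk_spec
  have h0 : T.val (T.box T.rk) = 0 := hvan _ fun h => by
    rw [T.box_mem_pad_iff] at h
    omega
  have hbox := T.box_tail 0
  simp only [add_zero] at hbox
  rw [← (headBox T).prod_comp, prod_range]
  refine prod_congr rfl fun i _ => ?_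
  rw [node_div_node, h0, hbox]
  have hc : content (0, T.rk - lam.card) = (T.rk : ℤ) - lam.card := by
    unfold content nMin at *
    push_cast
    omega
  rw [hc, Nat.cast_zero, zero_sub]
  rfl

theorem productSide_minTableau :
    productSide T (minTableau (T.isColStrict_restrict T.rk)) =
      (∏ i ∈ range T.rk, (1 - node T.val (T.box T.rk) / node T.val (T.box i))) /
        (1 - t) ^ T.rk * ∏ j ∈ range T.rk, ∏ i ∈ range j,
          pairRatio t (node T.val (T.box i)) (node T.val (T.box j)) := by
  classical
  have hpairs : ∏ j ∈ range T.rk, ∏ i ∈ range j,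
      pairRatio t (node T.val (T.box i)) (node T.val (T.box j)) =
      ∏ b : boxes (pad lam T.rk), ∏ b' : boxes (pad lam T.rk),
        (if Precedes (T.restrict T.rk) b b' then
          pairRatio t (node (T.restrict T.rk) b) (node (T.restrict T.rk) b') else 1) := by
    rw [← prod_pairs_fin_eq_range (fun i j =>
      pairRatio t (node T.val (T.box i)) (node T.val (T.box j))), ← (headBox T).prod_comp]
    refine prod_congr rfl fun i _ => ?_
    rw [← (headBox T).prod_comp]
    refine prod_congr rfl fun j _ => ?_
    exact if_congr (precedes_headBox_iff T).symm rfl rfl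
  rw [hpairs, prod_precedes_eq (T.isColStrict_restrict T.rk), prod_tail_factor, productSide,
    div_mul_eq_div_div]
  ring

end Assembly

end VVMac

theorem mainTheorem5 (lam : YoungDiagram) (T : VVMac.Omega lam) :
    (∃! M : VVMac.PSYT (VVMac.pad lam T.rk), VVMac.IsMinTableau (T.restrict T.rk) M) ∧
    (∀ τ : VVMac.APSYTOver T, (VVMac.Inv τ.1.label).Finite) ∧
    ∀ M : VVMac.PSYT (VVMac.pad lam T.rk), VVMac.IsMinTableau (T.restrict T.rk) M →
      HasSum (fun τ : VVMac.APSYTOver T => VVMac.seriesTerm T τ) (VVMac.productSide T M) := by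
  have hT := T.isColStrict_restrict T.rk
  refine ⟨⟨VVMac.minTableau hT, VVMac.isMinTableau_minTableau hT, fun M hM =>
    hM.eq_minTableau hT⟩, fun τ => τ.finite_Inv, fun M hM => ?_⟩
  rw [hM.eq_minTableau hT, VVMac.productSide_minTableau]
  exact VVMac.hasSum_seriesTerm T
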